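/- Let $\mathfrak g$ be a finite-dimensional simple complex Lie algebra of type $A_l$ ($l\ge 1$) or $C_l$ ($l\ge 2$), with Cartan subalgebra $\mathfrak h$, Chevalley generators $x_i,y_i,h_i$ ($1\le i\le l$) and Killing form $(\cdot,\cdot)$. Let $A=\mathbb C[t_1^{\pm1},\dots,t_n^{\pm1}]$, let $\Omega_A$ be the free $A$-module on $K_1,\dots,K_n$, let $dA\subset\Omega_A$ be the span of the elements $\sum_{i=1}^n m_it^mK_i$ ($m\in\mathbb Z^n$), and let $\mathcal K_A=\Omega_A/dA$. The toroidal Lie algebra is $$\widetilde{\mathfrak g}_n=(\mathfrak g\otimes A)\oplus\mathcal K_A\oplus D,\qquad D=\bigoplus_{i=1}^n\mathbb C d_i,$$ with brackets, writing $x(a)=x\otimes t^a$, $$[x(a),y(b)]=[x,y](a+b)+(x,y)\sum_{i=1}^n a_it^{a+b}K_i,\quad [d_i,x(a)]=a_ix(a),\quad [d_i,t^aK_j]=a_it^aK_j,$$ $$[d_i,d_j]=0,\quad [\mathfrak g\otimes A,\mathcal K_A]=[\mathcal K_A,\mathcal K_A]=0.$$ Put $\widetilde{\mathfrak h}_n=\mathfrak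 h\oplus D$. For an abelian subalgebra $\mathfrak b$ of a Lie algebra $\mathfrak a$, let $\mathcal M(\mathfrak a,\mathfrak b)$ be the category of $\mathfrak a$-modules whose restriction to $U(\mathfrak b)$ is free of rank one. For $\lambda\in(\mathbb C^*)^n$ and a $\mathfrak g$-module $M$, let $\widetilde M(\lambda,M)$ be the $\widetilde{\mathfrak g}_n$-module with underlying space $M\otimes\mathbb C[d_1,\dots,d_n]$ and action $$x(a)(v\otimes p)=\lambda^a\,(xv)\otimes\tau^a(p),\qquad t^aK_j(v\otimes p)=0,\qquad d_j(v\otimes p)=v\otimes d_jp$$ for $x\in\mathfrak g$, $a\in\mathbb Z^n$, $1\le j\le n$, where $\lambda^a=\lambda_1^{a_1}\cdots\lambda_n^{a_n}$ and $\tau^a(p)(d_1,\dots,d_n)=p(d_1-a_1,\dots,d_n-a_n)$. Theorem. A $\widetilde{\mathfrak g}_n$-module $N$ belongs to $\mathcal M(\widetilde{\mathfrak g}_n,\widetilde{\mathfrak h}_n)$ if and only if $N\cong\widetilde M(\lambda,M_{\mathfrak g})$ for some $\lambda\in(\mathbb C^*)^n$ and some $M_{\mathfrak g}\in\mathcal M(\mathfrak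 g,\mathfrak h)$. -/

import Mathlib

universe u v

open scoped TensorProduct

noncomputable section

/-! ### Modules that are free of rank one over `U(𝔟)` -/

section

attribute [local instance] LieRing.ofAssociativeRing

/-- For a Lie subalgebra `𝔟` of a complex Lie algebra `𝔞`, the restriction to `U(𝔟)` of the
`𝔞`-module `N` is isomorphic to the regular left module `U(𝔟)`. -/
def IsFreeRankOne {𝔞 : Type*} [LieRing 𝔞] [LieAlgebra ℂ 𝔞] (𝔟 : LieSubalgebra ℂ 𝔞)
    (N : Type*) [AddCommGroup N] [Module ℂ N] [LieRingModule 𝔞 N] [LieModule ℂ 𝔞 N] : Prop :=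
  ∃ e : N ≃ₗ[ℂ] UniversalEnvelopingAlgebra ℂ 𝔟,
    ∀ (u : UniversalEnvelopingAlgebra ℂ 𝔟) (v : N),
      e (UniversalEnvelopingAlgebra.lift ℂ ((LieModule.toEnd ℂ 𝔞 N).comp 𝔟.incl) u v) = u * e v

end

namespace Toroidal

/-! ### Laurent polynomials, degree derivations and the space `Ω_A / dA` -/

/-- `A = ℂ[t₁^{±1}, …, tₙ^{±1}]`; the monomial `t^a` is `AddMonoidAlgebra.single a 1`. -/
abbrev Laurent (n : ℕ) : Type := AddMonoidAlgebra ℂ (Fin n → ℤ)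

variable {n : ℕ}

/-- The monomial `t^a`. -/
def mono (a : Fin n → ℤ) : Laurent n := AddMonoidAlgebra.single a 1

/-- The number `∑ᵢ cᵢ aᵢ`. -/
def pairing (c : Fin n → ℂ) (a : Fin n → ℤ) : ℂ := ∑ i, c i * (a i : ℂ)

/-- The derivation `∑ᵢ cᵢ dᵢ`, `dᵢ = tᵢ ∂/∂tᵢ`, of `A`: it maps `t^a` to `(∑ᵢ cᵢ aᵢ) t^a`. -/
def degMap (c : Fin n → ℂ) : Laurent n →ₗ[ℂ] Laurent n :=
  (AddMonoidAlgebra.basis (Fin n → ℤ) ℂ).constr ℂ fun a => pairing c a • mono a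

/-- The free `A`-module `Ω_A = A K₁ ⊕ ⋯ ⊕ A Kₙ`. -/
abbrev Omega (n : ℕ) : Type := Fin n → Laurent n

/-- The element `∑ᵢ mᵢ t^m Kᵢ` of `Ω_A`. -/
def dMono (m : Fin n → ℤ) : Omega n := fun i => (m i : ℂ) • mono m

/-- The subspace `dA` of `Ω_A`. -/
def exactForms (n : ℕ) : Submodule ℂ (Omega n) :=
  Submodule.span ℂ (Set.range (dMono (n := n)))

/-- `𝒦_A = Ω_A / dA`. -/
abbrev KA (n : ℕ) : Type := Omega n ⧸ exactForms n

/-- The class of `t^a Kⱼ` in `𝒦_A`. -/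
def tK (a : Fin n → ℤ) (j : Fin n) : KA n :=
  (exactForms n).mkQ (Pi.single j (mono a))

lemma mono_eq_basis (a : Fin n → ℤ) : mono a = AddMonoidAlgebra.basis (Fin n → ℤ) ℂ a := rfl

@[simp] lemma degMap_mono (c : Fin n → ℂ) (a : Fin n → ℤ) :
    degMap c (mono a) = pairing c a • mono a := by
  rw [degMap, mono_eq_basis, Module.Basis.constr_basis, mono_eq_basis]

lemma pairing_add (c : Fin n → ℂ) (a b : Fin n → ℤ) :
    pairing c (a + b) = pairing c a + pairing c b := by
  simp [pairing, mul_add, Finset.sum_add_distrib]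

lemma pairing_single (i : Fin n) (a : Fin n → ℤ) :
    pairing (Pi.single i 1) a = (a i : ℂ) := by
  classical
  simp [pairing, Pi.single_apply]

lemma pairing_add_left (c c' : Fin n → ℂ) (a : Fin n → ℤ) :
    pairing (c + c') a = pairing c a + pairing c' a := by
  simp [pairing, add_mul, Finset.sum_add_distrib]

lemma pairing_smul_left (r : ℂ) (c : Fin n → ℂ) (a : Fin n → ℤ) :
    pairing (r • c) a = r * pairing c a := by
  simp [pairing, Finset.mul_sum, mul_assoc]

lemma pairing_zero_right (c : Fin n → ℂ) : pairing c (0 : Fin n → ℤ) = 0 := by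
  simp [pairing]

lemma laurent_hom_ext {V : Type*} [AddCommMonoid V] [Module ℂ V] {f g : Laurent n →ₗ[ℂ] V}
    (h : ∀ a, f (mono a) = g (mono a)) : f = g :=
  (AddMonoidAlgebra.basis (Fin n → ℤ) ℂ).ext h

lemma mono_mul (a b : Fin n → ℤ) : mono a * mono b = mono (a + b) := by
  simp [mono, AddMonoidAlgebra.single_mul_single]

lemma degMap_mul (c : Fin n → ℂ) (f g : Laurent n) :
    degMap c (f * g) = degMap c f * g + f * degMap c g := by
  have : (LinearMap.mul ℂ (Laurent n)).compr₂ (degMap c)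
      = (LinearMap.mul ℂ (Laurent n)).comp (degMap c)
        + (LinearMap.mul ℂ (Laurent n)).compl₂ (degMap c) := by
    refine laurent_hom_ext fun a => laurent_hom_ext fun b => ?_
    simp only [LinearMap.compr₂_apply, LinearMap.mul_apply', LinearMap.add_apply,
      LinearMap.comp_apply, LinearMap.compl₂_apply, degMap_mono, mono_mul, pairing_add,
      smul_mul_assoc, mul_smul_comm, add_smul]
  simpa using LinearMap.congr_fun₂ this f g

lemma degMap_comm (c c' : Fin n → ℂ) (f : Laurent n) :
    degMap c (degMap c' f) = degMap c' (degMap c f) := by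
  have : (degMap c).comp (degMap c') = (degMap c').comp (degMap c) := by
    refine laurent_hom_ext fun a => ?_
    simp [smul_smul, mul_comm]
  exact LinearMap.congr_fun this f

lemma degMap_add (c c' : Fin n → ℂ) : degMap (c + c') = degMap c + degMap c' := by
  refine laurent_hom_ext fun a => ?_
  simp [pairing_add_left, add_smul]

lemma degMap_smul (r : ℂ) (c : Fin n → ℂ) : degMap (r • c) = r • degMap c := by
  refine laurent_hom_ext fun a => ?_
  simp [pairing_smul_left, mul_smul]

/-- `c ↦ degMap c` as a linear map. -/
def degLin (n : ℕ) : (Fin n → ℂ) →ₗ[ℂ] Laurent n →ₗ[ℂ] Laurent n where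
  toFun := degMap
  map_add' := degMap_add
  map_smul' := degMap_smul

/-- `df = ∑ᵢ (dᵢ f) Kᵢ`, so that `d(t^m) = ∑ᵢ mᵢ t^m Kᵢ`. -/
def dForm (n : ℕ) : Laurent n →ₗ[ℂ] Omega n :=
  LinearMap.pi fun i => degMap (Pi.single i 1)

lemma dForm_mono (a : Fin n → ℤ) : dForm n (mono a) = dMono a := by
  funext i
  simp [dForm, dMono, pairing_single]

lemma dForm_mem (f : Laurent n) : dForm n f ∈ exactForms n := by
  have : (exactForms n).mkQ.comp (dForm n) = 0 := by
    refine laurent_hom_ext fun a => ?_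
    rw [LinearMap.comp_apply, dForm_mono, LinearMap.zero_apply, Submodule.mkQ_apply,
      Submodule.Quotient.mk_eq_zero]
    exact Submodule.subset_span ⟨a, rfl⟩
  rw [← Submodule.Quotient.mk_eq_zero]
  exact LinearMap.congr_fun this f

/-- The componentwise action of `∑ᵢ cᵢ dᵢ` on `Ω_A` (each `Kⱼ` has degree `0`). -/
def degOmega (c : Fin n → ℂ) : Omega n →ₗ[ℂ] Omega n :=
  LinearMap.pi fun i => (degMap c).comp (LinearMap.proj i)

lemma degOmega_dMono (c : Fin n → ℂ) (m : Fin n → ℤ) :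
    degOmega c (dMono m) = pairing c m • dMono m := by
  funext i
  simp [degOmega, dMono, smul_smul, mul_comm]

lemma degOmega_mem (c : Fin n → ℂ) :
    exactForms n ≤ (exactForms n).comap (degOmega c) := by
  refine Submodule.span_le.2 ?_
  rintro _ ⟨m, rfl⟩
  change degOmega c (dMono m) ∈ exactForms n
  rw [degOmega_dMono]
  exact Submodule.smul_mem _ _ (Submodule.subset_span ⟨m, rfl⟩)

/-- The action of `∑ᵢ cᵢ dᵢ` on `𝒦_A`: it maps `t^a Kⱼ` to `(∑ᵢ cᵢ aᵢ) t^a Kⱼ`. -/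
def degK (c : Fin n → ℂ) : KA n →ₗ[ℂ] KA n :=
  (exactForms n).mapQ (exactForms n) (degOmega c) (degOmega_mem c)

@[simp] lemma degK_mkQ (c : Fin n → ℂ) (w : Omega n) :
    degK c ((exactForms n).mkQ w) = (exactForms n).mkQ (degOmega c w) := rfl

lemma degK_add (c c' : Fin n → ℂ) : degK (c + c') = degK c + degK c' := by
  refine LinearMap.ext fun k => ?_
  obtain ⟨w, rfl⟩ := (exactForms n).mkQ_surjective k
  simp only [degK_mkQ, LinearMap.add_apply, ← map_add]
  congr 1
  funext i
  simp [degOmega, degMap_add]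

lemma degK_smul (r : ℂ) (c : Fin n → ℂ) : degK (r • c) = r • degK c := by
  refine LinearMap.ext fun k => ?_
  obtain ⟨w, rfl⟩ := (exactForms n).mkQ_surjective k
  simp only [degK_mkQ, LinearMap.smul_apply, ← map_smul]
  congr 1
  funext i
  simp [degOmega, degMap_smul]

lemma degK_comm (c c' : Fin n → ℂ) (k : KA n) :
    degK c (degK c' k) = degK c' (degK c k) := by
  obtain ⟨w, rfl⟩ := (exactForms n).mkQ_surjective k
  exact congrArg (exactForms n).mkQ (funext fun i => degMap_comm c c' (w i))

lemma degK_tK (c : Fin n → ℂ) (a : Fin n → ℤ) (j : Fin n) :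
    degK c (tK a j) = pairing c a • tK a j := by
  classical
  rw [tK, degK_mkQ, ← map_smul]
  congr 1
  funext i
  by_cases h : i = j
  · subst h; simp [degOmega]
  · simp [degOmega, Pi.single_eq_of_ne h]

/-- The class in `𝒦_A` of `(df) g = ∑ᵢ (dᵢ f) g Kᵢ`. -/
def formPair (n : ℕ) : Laurent n →ₗ[ℂ] Laurent n →ₗ[ℂ] KA n :=
  LinearMap.mk₂ ℂ (fun f g => (exactForms n).mkQ fun i => dForm n f i * g)
    (fun f f' g => by
      rw [← map_add]; congr 1; funext i; simp [add_mul])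
    (fun r f g => by
      rw [← map_smul]; congr 1; funext i; simp)
    (fun f g g' => by
      rw [← map_add]; congr 1; funext i; simp [mul_add])
    (fun r f g => by
      rw [← map_smul]; congr 1; funext i; simp)

lemma formPair_apply (f g : Laurent n) :
    formPair n f g = (exactForms n).mkQ fun i => dForm n f i * g := rfl

lemma formPair_mono (a b : Fin n → ℤ) :
    formPair n (mono a) (mono b) = ∑ i, (a i : ℂ) • tK (a + b) i := by
  classical
  simp only [formPair_apply, tK, dForm_mono, ← map_smul, ← map_sum]
  congr 1
  funext i
  simp only [dMono, smul_mul_assoc, mono_mul, Finset.sum_apply, Pi.smul_apply, Pi.single_apply]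
  simp

lemma formPair_add_swap (f g : Laurent n) : formPair n f g + formPair n g f = 0 := by
  have : formPair n f g + formPair n g f = (exactForms n).mkQ (dForm n (f * g)) := by
    rw [formPair_apply, formPair_apply, ← map_add]
    congr 1
    funext i
    simp [dForm, degMap_mul, mul_comm]
  rw [this, Submodule.mkQ_apply, Submodule.Quotient.mk_eq_zero]
  exact dForm_mem _

lemma formPair_mul (f g h : Laurent n) :
    formPair n f (g * h) + formPair n g (h * f) + formPair n h (f * g) = 0 := by
  have : formPair n f (g * h) + formPair n g (h * f) + formPair n h (f * g)
      = (exactForms n).mkQ (dForm n (f * g * h)) := by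
    rw [formPair_apply, formPair_apply, formPair_apply, ← map_add, ← map_add]
    congr 1
    funext i
    simp only [dForm, LinearMap.pi_apply, Pi.add_apply, degMap_mul]
    ring
  rw [this, Submodule.mkQ_apply, Submodule.Quotient.mk_eq_zero]
  exact dForm_mem _

lemma degK_formPair (c : Fin n → ℂ) (f g : Laurent n) :
    degK c (formPair n f g) = formPair n (degMap c f) g + formPair n f (degMap c g) := by
  rw [formPair_apply, formPair_apply, formPair_apply, degK_mkQ, ← map_add]
  congr 1
  funext i
  simp [degOmega, dForm, degMap_mul, degMap_comm c]

/-! ### The toroidal Lie algebra -/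

section algebra

variable (𝔤 : Type*) [LieRing 𝔤] [LieAlgebra ℂ 𝔤]

/-- The space `A ⊗ 𝔤` of the loop algebra. -/
abbrev Loop (n : ℕ) : Type _ := Laurent n ⊗[ℂ] 𝔤

variable {𝔤}

/-- The element `x(a) = x ⊗ t^a` of the loop algebra. -/
def loopElt (x : 𝔤) (a : Fin n → ℤ) : Loop 𝔤 n := mono a ⊗ₜ[ℂ] x

/-- The bracket of the loop algebra: `(f ⊗ x, g ⊗ y) ↦ fg ⊗ ⁅x, y⁆`. -/
def loopLie (𝔤 : Type*) [LieRing 𝔤] [LieAlgebra ℂ 𝔤] (n : ℕ) :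
    Loop 𝔤 n →ₗ[ℂ] Loop 𝔤 n →ₗ[ℂ] Loop 𝔤 n :=
  TensorProduct.curry <|
    TensorProduct.map (LinearMap.mul' ℂ (Laurent n))
        (LieModule.toModuleHom ℂ 𝔤 𝔤 : 𝔤 ⊗[ℂ] 𝔤 →ₗ[ℂ] 𝔤) ∘ₗ
      (TensorProduct.tensorTensorTensorComm ℂ (Laurent n) 𝔤 (Laurent n) 𝔤).toLinearMap

@[simp] lemma loopLie_tmul (f g : Laurent n) (x y : 𝔤) :
    loopLie 𝔤 n (f ⊗ₜ[ℂ] x) (g ⊗ₜ[ℂ] y) = (f * g) ⊗ₜ[ℂ] ⁅x, y⁆ := rfl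

lemma loopLie_add_swap (u v : Loop 𝔤 n) : loopLie 𝔤 n u v + loopLie 𝔤 n v u = 0 := by
  induction u using TensorProduct.induction_on with
  | zero => simp
  | add u u' hu hu' =>
    simp only [map_add, LinearMap.add_apply]
    rw [add_add_add_comm, hu, hu', add_zero]
  | tmul f x =>
    induction v using TensorProduct.induction_on with
    | zero => simp
    | add v v' hv hv' =>
      simp only [map_add, LinearMap.add_apply]
      rw [add_add_add_comm, hv, hv', add_zero]
    | tmul g y =>
      rw [loopLie_tmul, loopLie_tmul, mul_comm g f, ← TensorProduct.tmul_add,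
        ← lie_skew x y, neg_add_cancel, TensorProduct.tmul_zero]

lemma loopLie_skew (u v : Loop 𝔤 n) : loopLie 𝔤 n u v = -loopLie 𝔤 n v u :=
  eq_neg_of_add_eq_zero_left (loopLie_add_swap u v)

lemma loopLie_self (u : Loop 𝔤 n) : loopLie 𝔤 n u u = 0 := by
  have h := loopLie_add_swap u u
  rw [← two_smul ℂ] at h
  exact (smul_eq_zero.1 h).resolve_left two_ne_zero

lemma loopLie_leibniz (u v w : Loop 𝔤 n) :
    loopLie 𝔤 n u (loopLie 𝔤 n v w)
      = loopLie 𝔤 n (loopLie 𝔤 n u v) w + loopLie 𝔤 n v (loopLie 𝔤 n u w) := by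
  induction u using TensorProduct.induction_on with
  | zero => simp
  | add u u' hu hu' => simp only [map_add, LinearMap.add_apply, hu, hu']; abel
  | tmul f x =>
    induction v using TensorProduct.induction_on with
    | zero => simp
    | add v v' hv hv' => simp only [map_add, LinearMap.add_apply, hv, hv']; abel
    | tmul g y =>
      induction w using TensorProduct.induction_on with
      | zero => simp
      | add w w' hw hw' => simp only [map_add, hw, hw']; abel
      | tmul h z =>
        simp only [loopLie_tmul]
        rw [mul_left_comm g f h, ← mul_assoc, leibniz_lie x y z, TensorProduct.tmul_add]

/-- The action of `∑ᵢ cᵢ dᵢ` on the loop algebra: it maps `x(a)` to `(∑ᵢ cᵢ aᵢ) x(a)`. -/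
def degLoop (c : Fin n → ℂ) : Loop 𝔤 n →ₗ[ℂ] Loop 𝔤 n := (degMap c).rTensor 𝔤

@[simp] lemma degLoop_tmul (c : Fin n → ℂ) (f : Laurent n) (x : 𝔤) :
    degLoop c (f ⊗ₜ[ℂ] x : Loop 𝔤 n) = degMap c f ⊗ₜ[ℂ] x := rfl

lemma degLoop_add (c c' : Fin n → ℂ) :
    (degLoop (c + c') : Loop 𝔤 n →ₗ[ℂ] Loop 𝔤 n) = degLoop c + degLoop c' := by
  simp [degLoop, degMap_add, LinearMap.rTensor_add]

lemma degLoop_smul (r : ℂ) (c : Fin n → ℂ) :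
    (degLoop (r • c) : Loop 𝔤 n →ₗ[ℂ] Loop 𝔤 n) = r • degLoop c := by
  simp [degLoop, degMap_smul, LinearMap.rTensor_smul]

lemma degLoop_comm (c c' : Fin n → ℂ) (u : Loop 𝔤 n) :
    degLoop c (degLoop c' u) = degLoop c' (degLoop c u) := by
  induction u using TensorProduct.induction_on with
  | zero => simp
  | tmul f x => simp [degMap_comm c c']
  | add u v hu hv => simp only [map_add, hu, hv]

lemma degLoop_lie (c : Fin n → ℂ) (u v : Loop 𝔤 n) :
    degLoop c (loopLie 𝔤 n u v) = loopLie 𝔤 n (degLoop c u) v + loopLie 𝔤 n u (degLoop c v) := by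
  induction u using TensorProduct.induction_on with
  | zero => simp
  | add u u' hu hu' => simp only [map_add, LinearMap.add_apply, hu, hu']; abel
  | tmul f x =>
    induction v using TensorProduct.induction_on with
    | zero => simp
    | add v v' hv hv' => simp only [map_add, hv, hv']; abel
    | tmul g y => simp [degMap_mul, TensorProduct.add_tmul]

/-- The cocycle `(f ⊗ x, g ⊗ y) ↦ (x, y) · [(df) g]`, with `(x, y)` the Killing form. -/
def cocycle (𝔤 : Type*) [LieRing 𝔤] [LieAlgebra ℂ 𝔤] (n : ℕ) :
    Loop 𝔤 n →ₗ[ℂ] Loop 𝔤 n →ₗ[ℂ] KA n :=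
  TensorProduct.curry <|
    TensorProduct.lift (LinearMap.lsmul ℂ (KA n)).flip ∘ₗ
      TensorProduct.map (TensorProduct.lift (formPair n)) (TensorProduct.lift (killingForm ℂ 𝔤)) ∘ₗ
        (TensorProduct.tensorTensorTensorComm ℂ (Laurent n) 𝔤 (Laurent n) 𝔤).toLinearMap

@[simp] lemma cocycle_tmul (f g : Laurent n) (x y : 𝔤) :
    cocycle 𝔤 n (f ⊗ₜ[ℂ] x) (g ⊗ₜ[ℂ] y) = killingForm ℂ 𝔤 x y • formPair n f g := rfl

lemma cocycle_add_swap (u v : Loop 𝔤 n) : cocycle 𝔤 n u v + cocycle 𝔤 n v u = 0 := by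
  induction u using TensorProduct.induction_on with
  | zero => simp
  | add u u' hu hu' =>
    simp only [map_add, LinearMap.add_apply]
    rw [add_add_add_comm, hu, hu', add_zero]
  | tmul f x =>
    induction v using TensorProduct.induction_on with
    | zero => simp
    | add v v' hv hv' =>
      simp only [map_add, LinearMap.add_apply]
      rw [add_add_add_comm, hv, hv', add_zero]
    | tmul g y =>
      rw [cocycle_tmul, cocycle_tmul, LieModule.traceForm_comm ℂ 𝔤 𝔤 y x, ← smul_add,
        formPair_add_swap, smul_zero]

lemma cocycle_self (u : Loop 𝔤 n) : cocycle 𝔤 n u u = 0 := by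
  have h := cocycle_add_swap u u
  rw [← two_smul ℂ] at h
  exact (smul_eq_zero.1 h).resolve_left two_ne_zero

lemma cocycle_jacobi (u v w : Loop 𝔤 n) :
    cocycle 𝔤 n u (loopLie 𝔤 n v w) + cocycle 𝔤 n v (loopLie 𝔤 n w u) + cocycle 𝔤 n w (loopLie 𝔤 n u v) = 0 := by
  have add_aux : ∀ a b c a' b' c' : KA n, a + b + c = 0 → a' + b' + c' = 0 →
      (a + a') + (b + b') + (c + c') = 0 := by
    intro a b c a' b' c' h h'
    have : (a + a') + (b + b') + (c + c') = (a + b + c) + (a' + b' + c') := by abel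
    rw [this, h, h', add_zero]
  induction u using TensorProduct.induction_on with
  | zero => simp
  | add u u' hu hu' =>
    simp only [map_add, LinearMap.add_apply]
    exact add_aux _ _ _ _ _ _ hu hu'
  | tmul f x =>
    induction v using TensorProduct.induction_on with
    | zero => simp
    | add v v' hv hv' =>
      simp only [map_add, LinearMap.add_apply]
      exact add_aux _ _ _ _ _ _ hv hv'
    | tmul g y =>
      induction w using TensorProduct.induction_on with
      | zero => simp
      | add w w' hw hw' =>
        simp only [map_add, LinearMap.add_apply]
        exact add_aux _ _ _ _ _ _ hw hw'
      | tmul h z =>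
        simp only [loopLie_tmul, cocycle_tmul]
        have h1 : killingForm ℂ 𝔤 y ⁅z, x⁆ = killingForm ℂ 𝔤 x ⁅y, z⁆ := by
          rw [← LieModule.traceForm_apply_lie_apply ℂ 𝔤 𝔤 y z x,
            LieModule.traceForm_comm ℂ 𝔤 𝔤 ⁅y, z⁆ x]
        have h2 : killingForm ℂ 𝔤 z ⁅x, y⁆ = killingForm ℂ 𝔤 x ⁅y, z⁆ := by
          rw [LieModule.traceForm_comm ℂ 𝔤 𝔤 z ⁅x, y⁆,
            LieModule.traceForm_apply_lie_apply ℂ 𝔤 𝔤 x y z]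
        rw [h1, h2, ← smul_add, ← smul_add, formPair_mul, smul_zero]

lemma degK_cocycle (c : Fin n → ℂ) (u v : Loop 𝔤 n) :
    degK c (cocycle 𝔤 n u v) = cocycle 𝔤 n (degLoop c u) v + cocycle 𝔤 n u (degLoop c v) := by
  induction u using TensorProduct.induction_on with
  | zero => simp
  | add u u' hu hu' => simp only [map_add, LinearMap.add_apply, hu, hu']; abel
  | tmul f x =>
    induction v using TensorProduct.induction_on with
    | zero => simp
    | add v v' hv hv' => simp only [map_add, hv, hv']; abel
    | tmul g y => simp [degK_formPair, smul_add]

end algebra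

end Toroidal

open Toroidal

/-- The toroidal Lie algebra `𝔤̃ₙ = (A ⊗ 𝔤) ⊕ 𝒦_A ⊕ D`, as a vector space. The last component
`c` stands for `∑ᵢ cᵢ dᵢ ∈ D`. -/
@[ext] structure ToroidalAlgebra (n : ℕ) (𝔤 : Type*) [LieRing 𝔤] [LieAlgebra ℂ 𝔤] where
  /-- the component in the loop algebra -/
  loop : Loop 𝔤 n
  /-- the central component -/
  cent : KA n
  /-- the component in `D` -/
  deg : Fin n → ℂ

namespace ToroidalAlgebra

variable {n : ℕ} {𝔤 : Type*} [LieRing 𝔤] [LieAlgebra ℂ 𝔤]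

/-- The underlying set is a product. -/
def equivProd : ToroidalAlgebra n 𝔤 ≃ Loop 𝔤 n × KA n × (Fin n → ℂ) where
  toFun u := (u.loop, u.cent, u.deg)
  invFun p := ⟨p.1, p.2.1, p.2.2⟩
  left_inv _ := rfl
  right_inv _ := rfl

instance : AddCommGroup (ToroidalAlgebra n 𝔤) := equivProd.addCommGroup
instance : Module ℂ (ToroidalAlgebra n 𝔤) := equivProd.module ℂ

@[simp] lemma loop_add (u v : ToroidalAlgebra n 𝔤) : (u + v).loop = u.loop + v.loop := rfl
@[simp] lemma cent_add (u v : ToroidalAlgebra n 𝔤) : (u + v).cent = u.cent + v.cent := rfl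
@[simp] lemma deg_add (u v : ToroidalAlgebra n 𝔤) : (u + v).deg = u.deg + v.deg := rfl
@[simp] lemma loop_zero : (0 : ToroidalAlgebra n 𝔤).loop = 0 := rfl
@[simp] lemma cent_zero : (0 : ToroidalAlgebra n 𝔤).cent = 0 := rfl
@[simp] lemma deg_zero : (0 : ToroidalAlgebra n 𝔤).deg = 0 := rfl
@[simp] lemma loop_smul (r : ℂ) (u : ToroidalAlgebra n 𝔤) : (r • u).loop = r • u.loop := rfl
@[simp] lemma cent_smul (r : ℂ) (u : ToroidalAlgebra n 𝔤) : (r • u).cent = r • u.cent := rfl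
@[simp] lemma deg_smul (r : ℂ) (u : ToroidalAlgebra n 𝔤) : (r • u).deg = r • u.deg := rfl

/-- `⁅x(a), y(b)⁆ = ⁅x, y⁆(a+b) + (x, y) ∑ᵢ aᵢ t^{a+b} Kᵢ`, `𝒦_A` commutes with the loop algebra
and with itself, `D` is abelian and acts on the loop algebra and on `𝒦_A` by the degree. -/
instance : Bracket (ToroidalAlgebra n 𝔤) (ToroidalAlgebra n 𝔤) where
  bracket u v :=
    ⟨loopLie 𝔤 n u.loop v.loop + degLoop u.deg v.loop - degLoop v.deg u.loop,
      cocycle 𝔤 n u.loop v.loop + degK u.deg v.cent - degK v.deg u.cent, 0⟩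

@[simp] lemma loop_lie (u v : ToroidalAlgebra n 𝔤) :
    ⁅u, v⁆.loop = loopLie 𝔤 n u.loop v.loop + degLoop u.deg v.loop - degLoop v.deg u.loop := rfl
@[simp] lemma cent_lie (u v : ToroidalAlgebra n 𝔤) :
    ⁅u, v⁆.cent = cocycle 𝔤 n u.loop v.loop + degK u.deg v.cent - degK v.deg u.cent := rfl
@[simp] lemma deg_lie (u v : ToroidalAlgebra n 𝔤) : ⁅u, v⁆.deg = 0 := rfl

lemma degLoop_zero : (degLoop (0 : Fin n → ℂ) : Loop 𝔤 n →ₗ[ℂ] Loop 𝔤 n) = 0 := by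
  simpa using degLoop_smul (𝔤 := 𝔤) (0 : ℂ) (0 : Fin n → ℂ)

lemma degK_zero : (degK (0 : Fin n → ℂ)) = 0 := by
  simpa using degK_smul (0 : ℂ) (0 : Fin n → ℂ)

instance : LieRing (ToroidalAlgebra n 𝔤) where
  add_lie u v w := by
    ext1
    · simp only [loop_lie, loop_add, deg_add, degLoop_add, map_add, LinearMap.add_apply]
      abel
    · simp only [cent_lie, loop_add, cent_add, deg_add, degK_add, map_add, LinearMap.add_apply]
      abel
    · simp
  lie_add u v w := by
    ext1
    · simp only [loop_lie, loop_add, deg_add, degLoop_add, map_add, LinearMap.add_apply]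
      abel
    · simp only [cent_lie, loop_add, cent_add, deg_add, degK_add, map_add, LinearMap.add_apply]
      abel
    · simp
  lie_self u := by
    ext1
    · simp [loopLie_self]
    · simp [cocycle_self]
    · simp
  leibniz_lie u v w := by
    ext1
    · simp only [loop_lie, loop_add, deg_lie, degLoop_zero, LinearMap.zero_apply, map_add,
        map_sub, LinearMap.add_apply, LinearMap.sub_apply, degLoop_lie]
      rw [loopLie_leibniz u.loop v.loop w.loop, degLoop_comm u.deg v.deg, degLoop_comm u.deg w.deg,
        degLoop_comm v.deg w.deg, loopLie_skew v.loop (degLoop w.deg u.loop)]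
      abel
    · simp only [cent_lie, cent_add, loop_lie, deg_lie, degK_zero, LinearMap.zero_apply, map_add,
        map_sub, LinearMap.add_apply, LinearMap.sub_apply, degK_cocycle]
      have h := cocycle_jacobi u.loop v.loop w.loop
      rw [loopLie_skew w.loop u.loop, map_neg,
        eq_neg_of_add_eq_zero_left (cocycle_add_swap w.loop (loopLie 𝔤 n u.loop v.loop))] at h
      have h' : cocycle 𝔤 n u.loop (loopLie 𝔤 n v.loop w.loop)
          = cocycle 𝔤 n v.loop (loopLie 𝔤 n u.loop w.loop) + cocycle 𝔤 n (loopLie 𝔤 n u.loop v.loop) w.loop := by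
        rw [← sub_eq_zero, ← h]; abel
      rw [h', degK_comm u.deg v.deg, degK_comm u.deg w.deg, degK_comm v.deg w.deg,
        eq_neg_of_add_eq_zero_left (cocycle_add_swap v.loop (degLoop w.deg u.loop))]
      abel
    · simp

instance : LieAlgebra ℂ (ToroidalAlgebra n 𝔤) where
  lie_smul r u v := by
    ext1
    · simp only [loop_lie, loop_smul, deg_smul, degLoop_smul, map_smul,
        LinearMap.smul_apply, smul_add, smul_sub]
    · simp only [cent_lie, loop_smul, cent_smul, deg_smul, degK_smul, map_smul,
        LinearMap.smul_apply, smul_add, smul_sub]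
    · simp

/-- The element `x(a) = x ⊗ t^a`. -/
def elt (x : 𝔤) (a : Fin n → ℤ) : ToroidalAlgebra n 𝔤 := ⟨loopElt x a, 0, 0⟩

/-- The central element `t^a Kⱼ`. -/
def central (a : Fin n → ℤ) (j : Fin n) : ToroidalAlgebra n 𝔤 := ⟨0, tK a j, 0⟩

/-- The derivation `dᵢ`. -/
def der (i : Fin n) : ToroidalAlgebra n 𝔤 := ⟨0, 0, Pi.single i 1⟩

lemma elt_lie_elt (x y : 𝔤) (a b : Fin n → ℤ) :
    ⁅(elt x a : ToroidalAlgebra n 𝔤), elt y b⁆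
      = elt ⁅x, y⁆ (a + b) + killingForm ℂ 𝔤 x y • ∑ i, (a i : ℂ) • central (a + b) i := by
  have hs : ∀ (s : Finset (Fin n)) (z : Fin n → ToroidalAlgebra n 𝔤),
      (∑ i ∈ s, z i).loop = ∑ i ∈ s, (z i).loop ∧ (∑ i ∈ s, z i).cent = ∑ i ∈ s, (z i).cent ∧
        (∑ i ∈ s, z i).deg = ∑ i ∈ s, (z i).deg := by
    classical
    intro s z
    induction s using Finset.induction_on with
    | empty => simp
    | insert i s hi ih => simp [Finset.sum_insert hi, ih]
  ext1
  · simp [elt, central, loopElt, hs, degLoop_zero, mono_mul]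
  · simp [elt, central, loopElt, hs, degK_zero, formPair_mono]
  · simp [elt, central, hs]

lemma der_lie_elt (i : Fin n) (x : 𝔤) (a : Fin n → ℤ) :
    ⁅(der i : ToroidalAlgebra n 𝔤), elt x a⁆ = (a i : ℂ) • elt x a := by
  ext1
  · simp [der, elt, loopElt, degLoop_zero, pairing_single, TensorProduct.smul_tmul']
  · simp [der, elt]
  · simp [der, elt]

lemma der_lie_central (i : Fin n) (a : Fin n → ℤ) (j : Fin n) :
    ⁅(der i : ToroidalAlgebra n 𝔤), (central a j : ToroidalAlgebra n 𝔤)⁆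
      = (a i : ℂ) • central a j := by
  ext1
  · simp [der, central]
  · simp [der, central, degK_tK, pairing_single]
  · simp [der, central]

/-- The Cartan subalgebra `𝔥̃ₙ = 𝔥 ⊕ D` of `𝔤̃ₙ`, with `𝔥` embedded as `𝔥 ⊗ 1`. -/
def cartan (n : ℕ) (𝔥 : LieSubalgebra ℂ 𝔤) : LieSubalgebra ℂ (ToroidalAlgebra n 𝔤) where
  carrier := {u | (∃ h ∈ 𝔥, u.loop = loopElt h 0) ∧ u.cent = 0}
  zero_mem' := ⟨⟨0, 𝔥.zero_mem, by simp [loopElt]⟩, rfl⟩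
  add_mem' := by
    rintro u v ⟨⟨h, hh, hu⟩, hu'⟩ ⟨⟨k, hk, hv⟩, hv'⟩
    exact ⟨⟨h + k, 𝔥.add_mem hh hk, by simp [hu, hv, loopElt, TensorProduct.tmul_add]⟩,
      by simp [hu', hv']⟩
  smul_mem' := by
    rintro r u ⟨⟨h, hh, hu⟩, hu'⟩
    exact ⟨⟨r • h, 𝔥.smul_mem r hh, by simp [hu, loopElt]⟩, by simp [hu']⟩
  lie_mem' := by
    rintro u v ⟨⟨h, hh, hu⟩, hu'⟩ ⟨⟨k, hk, hv⟩, hv'⟩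
    refine ⟨⟨⁅h, k⁆, 𝔥.lie_mem hh hk, ?_⟩, ?_⟩
    · simp [hu, hv, loopElt, pairing_zero_right, mono_mul]
    · simp [hu, hv, hu', hv', loopElt, formPair_mono]

end ToroidalAlgebra

/-! ### The modules `M̃(λ, M)` -/

namespace Toroidal

variable {n : ℕ}

/-- The polynomial algebra `𝒫_D = ℂ[d₁, …, dₙ]`. -/
abbrev PD (n : ℕ) : Type := MvPolynomial (Fin n) ℂ

/-- The shift `τ^a`: the algebra endomorphism of `ℂ[d₁, …, dₙ]` with `dᵢ ↦ dᵢ - aᵢ`. -/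
def shift (a : Fin n → ℤ) : PD n →ₐ[ℂ] PD n :=
  MvPolynomial.aeval fun i => MvPolynomial.X i - MvPolynomial.C (a i : ℂ)

/-- `λ^a = λ₁^{a₁} ⋯ λₙ^{aₙ}`. -/
def monoVal (lam : Fin n → ℂˣ) (a : Fin n → ℤ) : ℂˣ := ∏ i, lam i ^ a i

lemma monoVal_add (lam : Fin n → ℂˣ) (a b : Fin n → ℤ) :
    monoVal lam (a + b) = monoVal lam a * monoVal lam b := by
  simp [monoVal, zpow_add, Finset.prod_mul_distrib]

lemma shift_X (a : Fin n → ℤ) (i : Fin n) :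
    shift a (MvPolynomial.X i) = MvPolynomial.X i - MvPolynomial.C (a i : ℂ) := by
  simp [shift]

lemma shift_add (a b : Fin n → ℤ) (p : PD n) : shift (a + b) p = shift a (shift b p) := by
  have : shift (a + b) = (shift a).comp (shift b) := by
    refine MvPolynomial.algHom_ext fun i => ?_
    rw [AlgHom.comp_apply, shift_X, shift_X, map_sub, shift_X, ← MvPolynomial.algebraMap_eq,
      AlgHom.commutes]
    simp only [Pi.add_apply, Int.cast_add, map_add]
    ring
  rw [this, AlgHom.comp_apply]

/-- The action of `A` on `ℂ[d₁, …, dₙ]` for which `t^a` acts as `λ^a τ^a`. -/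
def laurentAct (lam : Fin n → ℂˣ) : Laurent n →ₗ[ℂ] Module.End ℂ (PD n) :=
  (AddMonoidAlgebra.basis (Fin n → ℤ) ℂ).constr ℂ fun a => (monoVal lam a : ℂ) • (shift a).toLinearMap

lemma laurentAct_mono (lam : Fin n → ℂˣ) (a : Fin n → ℤ) (p : PD n) :
    laurentAct lam (mono a) p = (monoVal lam a : ℂ) • shift a p := by
  rw [laurentAct, mono_eq_basis, Module.Basis.constr_basis]
  rfl

lemma laurentAct_mul (lam : Fin n → ℂˣ) (f g : Laurent n) (p : PD n) :
    laurentAct lam (f * g) p = laurentAct lam f (laurentAct lam g p) := by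
  have : (LinearMap.mul ℂ (Laurent n)).compr₂ (laurentAct lam)
      = ((LinearMap.mul ℂ (Module.End ℂ (PD n))).comp (laurentAct lam)).compl₂
          (laurentAct lam) := by
    refine laurent_hom_ext fun a => laurent_hom_ext fun b => LinearMap.ext fun p => ?_
    simp only [LinearMap.compr₂_apply, LinearMap.mul_apply', LinearMap.compl₂_apply,
      LinearMap.comp_apply, Module.End.mul_apply, mono_mul, laurentAct_mono, map_smul, smul_smul,
      shift_add, monoVal_add, Units.val_mul, mul_comm]
  have h := LinearMap.congr_fun₂ this f g
  simpa using LinearMap.congr_fun h p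

/-- The polynomial `∑ᵢ cᵢ dᵢ`. -/
def degPoly (n : ℕ) : (Fin n → ℂ) →ₗ[ℂ] PD n where
  toFun c := ∑ i, c i • MvPolynomial.X i
  map_add' c c' := by simp [add_smul, Finset.sum_add_distrib]
  map_smul' r c := by simp [Finset.smul_sum, mul_smul]

lemma shift_degPoly (a : Fin n → ℤ) (c : Fin n → ℂ) :
    shift a (degPoly n c) = degPoly n c - MvPolynomial.C (pairing c a) := by
  simp only [degPoly, LinearMap.coe_mk, AddHom.coe_mk, map_sum, map_smul, shift_X, smul_sub,
    Finset.sum_sub_distrib, pairing]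
  congr 1
  refine Finset.sum_congr rfl fun i _ => ?_
  rw [MvPolynomial.smul_eq_C_mul, ← map_mul]

lemma degPoly_laurentAct (lam : Fin n → ℂˣ) (c : Fin n → ℂ) (f : Laurent n) (p : PD n) :
    degPoly n c * laurentAct lam f p - laurentAct lam f (degPoly n c * p)
      = laurentAct lam (degMap c f) p := by
  have : (LinearMap.mulLeft ℂ (degPoly n c)).compRight ℂ ∘ₗ laurentAct lam
      - (LinearMap.lcomp ℂ (PD n) (LinearMap.mulLeft ℂ (degPoly n c))) ∘ₗ laurentAct lam
      = laurentAct lam ∘ₗ degMap c := by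
    refine laurent_hom_ext fun a => LinearMap.ext fun p => ?_
    change degPoly n c * laurentAct lam (mono a) p - laurentAct lam (mono a) (degPoly n c * p)
      = laurentAct lam (degMap c (mono a)) p
    rw [degMap_mono, map_smul, LinearMap.smul_apply]
    simp only [laurentAct_mono, map_mul, shift_degPoly, MvPolynomial.smul_eq_C_mul]
    ring
  exact LinearMap.congr_fun (LinearMap.congr_fun this f) p

end Toroidal

/-- The underlying space `M ⊗ ℂ[d₁, …, dₙ]` of the module `M̃(λ, M)`. -/
def TildeModule {n : ℕ} (_lam : Fin n → ℂˣ) (M : Type*) [AddCommGroup M] [Module ℂ M] : Type _ :=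
  M ⊗[ℂ] PD n

namespace TildeModule

variable {n : ℕ} (lam : Fin n → ℂˣ) (M : Type*) [AddCommGroup M] [Module ℂ M]

instance : AddCommGroup (TildeModule lam M) := inferInstanceAs (AddCommGroup (M ⊗[ℂ] PD n))
instance : Module ℂ (TildeModule lam M) := inferInstanceAs (Module ℂ (M ⊗[ℂ] PD n))

/-- The element `v ⊗ p` of `M̃(λ, M)`. -/
def mk (v : M) (p : PD n) : TildeModule lam M := (v ⊗ₜ[ℂ] p : M ⊗[ℂ] PD n)

variable {𝔤 : Type*} [LieRing 𝔤] [LieAlgebra ℂ 𝔤] [LieRingModule 𝔤 M] [LieModule ℂ 𝔤 M]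

/-- The action of the loop algebra: `f ⊗ x` maps `v ⊗ p` to `⁅x, v⁆ ⊗ f p`, where `A` acts on
`ℂ[d₁, …, dₙ]` by `t^a p = λ^a τ^a(p)`. -/
def loopAct : Loop 𝔤 n →ₗ[ℂ] Module.End ℂ (M ⊗[ℂ] PD n) :=
  TensorProduct.lift <| LinearMap.mk₂ ℂ
    (fun f x => TensorProduct.map (LieModule.toEnd ℂ 𝔤 M x) (laurentAct lam f))
    (fun f f' x => by rw [map_add, TensorProduct.map_add_right])
    (fun r f x => by rw [map_smul, TensorProduct.map_smul_right])
    (fun f x x' => by rw [map_add, TensorProduct.map_add_left])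
    (fun r f x => by rw [map_smul, TensorProduct.map_smul_left])

lemma loopAct_tmul (f : Laurent n) (x : 𝔤) (v : M) (p : PD n) :
    loopAct lam M (f ⊗ₜ[ℂ] x : Loop 𝔤 n) (v ⊗ₜ[ℂ] p) = ⁅x, v⁆ ⊗ₜ[ℂ] laurentAct lam f p := rfl

/-- The action of `𝔤̃ₙ`: the loop algebra acts by `loopAct`, `𝒦_A` by zero, and `dᵢ` by
multiplication by `dᵢ` on the second factor. -/
def act : ToroidalAlgebra n 𝔤 →ₗ[ℂ] Module.End ℂ (M ⊗[ℂ] PD n) where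
  toFun u := loopAct lam M u.loop +
    (LinearMap.mulLeft ℂ (degPoly n u.deg)).lTensor M
  map_add' u v := by
    refine TensorProduct.ext' fun m p => ?_
    simp [add_mul, TensorProduct.tmul_add]
    abel
  map_smul' r u := by
    refine TensorProduct.ext' fun m p => ?_
    simp

lemma act_apply (u : ToroidalAlgebra n 𝔤) (w : M ⊗[ℂ] PD n) :
    act lam M u w = loopAct lam M u.loop w
      + (LinearMap.mulLeft ℂ (degPoly n u.deg)).lTensor M w := rfl

lemma loopAct_lie (u v : Loop 𝔤 n) (w : M ⊗[ℂ] PD n) :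
    loopAct lam M (loopLie 𝔤 n u v) w
      = loopAct lam M u (loopAct lam M v w) - loopAct lam M v (loopAct lam M u w) := by
  induction u using TensorProduct.induction_on with
  | zero => simp
  | add u u' hu hu' => simp only [map_add, LinearMap.add_apply, hu, hu']; abel
  | tmul f x =>
    induction v using TensorProduct.induction_on with
    | zero => simp
    | add v v' hv hv' => simp only [map_add, LinearMap.add_apply, hv, hv']; abel
    | tmul g y =>
      induction w using TensorProduct.induction_on with
      | zero => simp
      | add w w' hw hw' => simp only [map_add, hw, hw']; abel
      | tmul m p =>
        simp only [loopLie_tmul, loopAct_tmul]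
        rw [← laurentAct_mul, ← laurentAct_mul, mul_comm g f, ← TensorProduct.sub_tmul, lie_lie]

lemma loopAct_deg (c : Fin n → ℂ) (u : Loop 𝔤 n) (w : M ⊗[ℂ] PD n) :
    loopAct lam M (degLoop c u) w
      = (LinearMap.mulLeft ℂ (degPoly n c)).lTensor M (loopAct lam M u w)
        - loopAct lam M u ((LinearMap.mulLeft ℂ (degPoly n c)).lTensor M w) := by
  induction u using TensorProduct.induction_on with
  | zero => simp
  | add u u' hu hu' => simp only [map_add, LinearMap.add_apply, hu, hu']; abel
  | tmul f x =>
    induction w using TensorProduct.induction_on with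
    | zero => simp
    | add w w' hw hw' => simp only [map_add, hw, hw']; abel
    | tmul m p =>
      simp only [degLoop_tmul, loopAct_tmul, LinearMap.lTensor_tmul, LinearMap.mulLeft_apply]
      rw [← TensorProduct.tmul_sub, degPoly_laurentAct]

lemma mulLeft_comm (c c' : Fin n → ℂ) (w : M ⊗[ℂ] PD n) :
    (LinearMap.mulLeft ℂ (degPoly n c)).lTensor M ((LinearMap.mulLeft ℂ (degPoly n c')).lTensor M w)
      = (LinearMap.mulLeft ℂ (degPoly n c')).lTensor M
          ((LinearMap.mulLeft ℂ (degPoly n c)).lTensor M w) := by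
  induction w using TensorProduct.induction_on with
  | zero => simp
  | add w w' hw hw' => simp only [map_add, hw, hw']
  | tmul m p => simp [mul_left_comm]

lemma act_leibniz (u v : ToroidalAlgebra n 𝔤) (w : M ⊗[ℂ] PD n) :
    act lam M u (act lam M v w) = act lam M ⁅u, v⁆ w + act lam M v (act lam M u w) := by
  simp only [act_apply, ToroidalAlgebra.loop_lie, ToroidalAlgebra.deg_lie, map_add, map_sub,
    LinearMap.add_apply, LinearMap.sub_apply, loopAct_lie, loopAct_deg, map_zero,
    mulLeft_comm M u.deg v.deg, LinearMap.mulLeft_zero_eq_zero, LinearMap.lTensor_zero,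
    LinearMap.zero_apply]
  abel

instance : LieRingModule (ToroidalAlgebra n 𝔤) (TildeModule lam M) where
  bracket u w := act lam M u w
  add_lie u v w := LinearMap.congr_fun (map_add (act lam M) u v) w
  lie_add u w w' := map_add (act lam M u) w w'
  leibniz_lie u v w := act_leibniz lam M u v w

instance : LieModule ℂ (ToroidalAlgebra n 𝔤) (TildeModule lam M) where
  smul_lie r u w := LinearMap.congr_fun (map_smul (act lam M) r u) w
  lie_smul r u w := map_smul (act lam M u) r w

/-- `x(a) (v ⊗ p) = λ^a (x v) ⊗ τ^a(p)`. -/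
lemma elt_lie_mk (x : 𝔤) (a : Fin n → ℤ) (v : M) (p : PD n) :
    ⁅(ToroidalAlgebra.elt x a : ToroidalAlgebra n 𝔤), mk lam M v p⁆
      = (monoVal lam a : ℂ) • mk lam M ⁅x, v⁆ (shift a p) := by
  change act lam M _ (v ⊗ₜ[ℂ] p) = (monoVal lam a : ℂ) • (⁅x, v⁆ ⊗ₜ[ℂ] shift a p)
  simp [act_apply, ToroidalAlgebra.elt, loopElt, loopAct_tmul, laurentAct_mono]

/-- `t^a Kⱼ` acts by zero. -/
lemma central_lie (a : Fin n → ℤ) (j : Fin n) (w : TildeModule lam M) :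
    ⁅(ToroidalAlgebra.central a j : ToroidalAlgebra n 𝔤), w⁆ = 0 := by
  have h : act lam M (ToroidalAlgebra.central a j : ToroidalAlgebra n 𝔤) = 0 :=
    LinearMap.ext fun w => by simp [act_apply, ToroidalAlgebra.central]
  exact LinearMap.congr_fun h w

/-- `dⱼ (v ⊗ p) = v ⊗ dⱼ p`. -/
lemma der_lie_mk (j : Fin n) (v : M) (p : PD n) :
    ⁅(ToroidalAlgebra.der j : ToroidalAlgebra n 𝔤), mk lam M v p⁆
      = mk lam M v (MvPolynomial.X j * p) := by
  classical
  change act lam M _ (v ⊗ₜ[ℂ] p) = v ⊗ₜ[ℂ] (MvPolynomial.X j * p)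
  simp [act_apply, ToroidalAlgebra.der, degPoly, Pi.single_apply]

end TildeModule

end

/-! The ring `U(𝔥̃ₙ)` is a polynomial ring and `N` is a copy of it. A weight vector `x` of weight
`χ` then acts by `x · u = σ(u) (x · 1)`, where `σ` is the translation `y ↦ y - χ(y)`
(`map_lie_of_weight`). So `x` is known from the single polynomial `x · 1`, and Lie brackets become
difference equations between such polynomials.

One simple root is treated at a time (`exists_character_of_sl2`). Write `U(𝔥̃ₙ) = B[X]` with `X =
hᵢ` and `B` the polynomial ring on the kernel of `αᵢ`, which contains `D`. Let `E a`, `F a`, `H a`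
be the values of `e(a)`, `f(a)`, `h(a)` on the generator, and `τ a` the translation of `B` in degree
`a`. Only brackets without a central term are used: `(h, x) = 0` for a root vector `x`, and the
central term of `[x(a), y(0)]` is a multiple of the class of `d(t^a)`, which is zero. The claim
(`LoopSl2System.exists_character`) is that `E 0` and `F 0` are fixed by all `τ a`, and that `E a`,
`F a`, `H a` are `r(a)` times their values at `0`, for one character `r`. The Casimir element makes
a translate of `E 0` times `F 0` a quadratic polynomial in `X` with unit leading coefficient, so the
two degrees add up to `2`. The relation `[e(a), e(0)] = 0`, read in the two top coefficients, says
that `τ a` moves the second coefficient of `E 0` by a multiple of `deg E a - deg E 0`. This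
difference is additive along multiples of `a`, so it vanishes because degrees are not negative
(`map_nextCoeff_E`). That settles degree at most one. If `E 0` is constant and `F 0` quadratic, the
unknown is the Casimir scalar, and `[f(a), f(0)] = 0` yields a quadratic condition which only
invariant scalars satisfy (`apply_eq_of_quadratic`). Finally `E a / E 0` is invariant under a
translation of `X`, hence lies in `B`.

Units of `B` are nonzero complex numbers, so `r(a) = λ^a`; invariance under `τ` places `E 0` and `F
0` in `U(𝔥)` (`exists_inclU_eq`). The bracket `[hⱼ(a), eᵢ(0)]` forces equal `λ` at adjacent nodes,
and the Dynkin diagrams of types `A` and `C` are paths. Since the Chevalley generators generate `𝔤`,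
each `x(a)` acts on `U(𝔥) · 1` as `λ^a x(0)` (`exists_elt_lie_inclU`). Comparing `[e(a), f(c)]` with
`h(a + c)` shows that the centre acts by zero (`central_lie_eq_zero`). Hence `M = U(𝔥) · 1` is a
`𝔤`-module and `N` is `M ⊗ ℂ[d₁, …, dₙ]` (`exists_equiv_tildeModule`). The converse is the
decomposition `U(𝔥̃ₙ) = U(𝔥) ⊗ ℂ[d₁, …, dₙ]`. -/

open Toroidal

noncomputable section

/-! ### Top coefficients and translations of one-variable polynomials. -/

namespace Polynomial

variable {B : Type*} [CommRing B]

/-- The second coefficient is the linear coefficient of the reversed polynomial, and reversal is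
multiplicative over a domain. -/
lemma nextCoeff_mul_of_domain [IsDomain B] (p q : B[X]) :
    (p * q).nextCoeff = p.leadingCoeff * q.nextCoeff + p.nextCoeff * q.leadingCoeff := by
  rw [← coeff_one_reverse, reverse_mul_of_domain, mul_coeff_one, coeff_one_reverse,
    coeff_one_reverse, coeff_zero_reverse, coeff_zero_reverse]

lemma nextCoeff_taylor (p : B[X]) (s : B) :
    (taylor s p).nextCoeff = p.nextCoeff + p.natDegree * s * p.leadingCoeff := by
  rcases Nat.eq_zero_or_pos p.natDegree with h | h
  · simp [nextCoeff, h]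
  · rw [nextCoeff_of_natDegree_pos h, nextCoeff_of_natDegree_pos (by rwa [natDegree_taylor]),
      natDegree_taylor, taylor_coeff,
      -- The Hasse derivative of order `p.natDegree - 1` has degree at most one, so two terms
      -- suffice.
      eval_eq_sum_range' (n := 2) ((natDegree_hasseDeriv_le p _).trans_lt (by omega))]
    obtain ⟨m, hm⟩ : ∃ m, p.natDegree = m + 1 := ⟨p.natDegree - 1, by omega⟩
    simp only [Finset.sum_range_succ, Finset.sum_range_zero, hasseDeriv_coeff, leadingCoeff, hm]
    simp [add_comm 1 m]
    ring

lemma map_nextCoeff_of_leadingCoeff_ne {B' : Type*} [CommRing B'] (f : B →+* B') {p : B[X]}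
    (h : f p.leadingCoeff ≠ 0) : (p.map f).nextCoeff = f p.nextCoeff := by
  rw [nextCoeff, nextCoeff, natDegree_map_of_leadingCoeff_ne_zero f h]
  split_ifs <;> simp

/-- Comparison of the two top coefficients in the commutation relation `p · S T q = q · S p`,
where `S` is a translation of the variable and `T` acts on the coefficients. -/
lemma nextCoeff_of_mul_taylor_eq [IsDomain B] (f : B →+* B) (s : B) {p q : B[X]} (hp : p ≠ 0)
    (hq : q ≠ 0) (hf : f q.leadingCoeff = q.leadingCoeff)
    (h : p * taylor s (q.map f) = q * taylor s p) :
    f q.nextCoeff - q.nextCoeff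
      = (p.natDegree - q.natDegree : B) * s * q.leadingCoeff := by
  have hlc : f q.leadingCoeff ≠ 0 := by rw [hf]; exact leadingCoeff_ne_zero.2 hq
  have h' := congrArg nextCoeff h
  rw [nextCoeff_mul_of_domain, nextCoeff_mul_of_domain, nextCoeff_taylor, nextCoeff_taylor,
    leadingCoeff_taylor, leadingCoeff_taylor, map_nextCoeff_of_leadingCoeff_ne f hlc,
    leadingCoeff_map_of_leadingCoeff_ne_zero f hlc, natDegree_map_of_leadingCoeff_ne_zero f hlc,
    hf] at h'
  have : p.leadingCoeff * (f q.nextCoeff - q.nextCoeff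
      - (p.natDegree - q.natDegree : B) * s * q.leadingCoeff) = 0 := by
    linear_combination h'
  exact sub_eq_zero.1 ((mul_eq_zero.1 this).resolve_left (leadingCoeff_ne_zero.2 hp))

/-- If `p / q` is invariant under a translation of the variable, then it is a constant. -/
lemma eq_C_mul_of_mul_taylor_eq [IsDomain B] [CharZero B] {s : B} (hs : s ≠ 0) {p q : B[X]}
    (hq : IsUnit q.leadingCoeff) (h : p * taylor s q = q * taylor s p) : ∃ r, p = C r * q := by
  have hq0 : q ≠ 0 := fun h0 => by simp [h0] at hq
  -- With trivial action on coefficients, the comparison of second coefficients leaves only the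
  -- difference of the degrees.
  have key : ∀ p' : B[X], p' ≠ 0 → p' * taylor s q = q * taylor s p' →
      p'.natDegree = q.natDegree := by
    intro p' hp' h'
    have := nextCoeff_of_mul_taylor_eq (RingHom.id B) s hp' hq0 rfl (by simpa using h')
    rw [RingHom.id_apply, sub_self, zero_eq_mul, mul_eq_zero, sub_eq_zero, Nat.cast_inj] at this
    simpa [hs, hq0] using this
  obtain ⟨u, hu⟩ := hq
  refine ⟨p.leadingCoeff * (u⁻¹ : Bˣ), ?_⟩
  by_cases hp : p = 0
  · simp [hp]
  by_contra hne
  have hne' := sub_ne_zero.2 hne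
  -- The difference solves the same equation, so it must also have the degree of `q`, although its
  -- leading term has been cancelled.
  have hdeg := key _ hne' (by
    simp only [map_sub, taylor_mul, taylor_C]
    linear_combination h)
  have hpd := key p hp h
  have hlt : (p - C (p.leadingCoeff * (u⁻¹ : Bˣ)) * q).degree < p.degree := by
    refine degree_sub_lt_left ?_ hp ?_
    · rw [degree_C_mul (by simp [hp]), degree_eq_natDegree hp, degree_eq_natDegree hq0, hpd]
    · rw [leadingCoeff_mul, leadingCoeff_C, mul_assoc, ← hu, Units.inv_mul, mul_one]
  have := natDegree_lt_natDegree hne' hlt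
  omega

lemma eq_C_of_taylor_eq [IsDomain B] [CharZero B] {s : B} (hs : s ≠ 0) {p : B[X]}
    (h : taylor s p = p) : ∃ r, p = C r := by
  obtain ⟨r, hr⟩ := eq_C_mul_of_mul_taylor_eq hs (p := p) (q := 1) (by simp) (by simp [h])
  exact ⟨r, by simpa using hr⟩

end Polynomial

/-! ### Difference equations for the loop algebra of `𝔰𝔩₂`. -/

open Polynomial

/-- The structure polynomials of the action of `𝔰𝔩₂ ⊗ A` on `B[X]`, where the Cartan element `h`
acts by multiplication by `X` and the degree derivations are contained in the coefficient ring `B`.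
The families `E`, `F`, `H` are the images of `1` under `e(a)`, `f(a)`, `h(a)`. -/
structure LoopSl2System {G B : Type*} [AddCommGroup G] [CommRing B] (τ : G → B →+* B)
    (E F H : G → B[X]) : Prop where
  h_zero : H 0 = X
  he : ∀ a b, H a * (E b).map (τ a) - E b * taylor (-2) ((H a).map (τ b)) = 2 * E (a + b)
  hf : ∀ a b, H a * (F b).map (τ a) - F b * taylor 2 ((H a).map (τ b)) = -(2 * F (a + b))
  -- From here on one argument has degree zero, so that the bracket has no central term.
  ef_left : ∀ a, E a * taylor (-2) ((F 0).map (τ a)) - F 0 * taylor 2 (E a) = H a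
  ef_right : ∀ a, E 0 * taylor (-2) (F a) - F a * taylor 2 ((E 0).map (τ a)) = H a
  ee : ∀ a, E a * taylor (-2) ((E 0).map (τ a)) = E 0 * taylor (-2) (E a)
  ff : ∀ a, F a * taylor 2 ((F 0).map (τ a)) = F 0 * taylor 2 (F a)

/-- A family of ring endomorphisms of `B` indexed by a group, without nontrivial action on units
and without proper orbits of order two. -/
structure IsTranslationAction {G B : Type*} [AddCommGroup G] [CommRing B] (τ : G → B →+* B) :
    Prop where
  zero : τ 0 = RingHom.id B
  add : ∀ a b x, τ (a + b) x = τ a (τ b x)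
  unit : ∀ a x, IsUnit x → τ a x = x
  two : ∀ a x, τ (a + a) x = x → τ a x = x

namespace IsTranslationAction

variable {G B : Type*} [AddCommGroup G] [CommRing B] {τ : G → B →+* B}

lemma zero_apply (hτ : IsTranslationAction τ) (x : B) : τ 0 x = x := by rw [hτ.zero]; rfl

/-- An invariant defect accumulates linearly along multiples of `a`. In `map_nextCoeff_E` the defect
is a difference of degrees, which is bounded below. -/
lemma apply_nsmul_sub (hτ : IsTranslationAction τ) {a : G} {x c : B} (hc : ∀ b, τ b c = c)
    (h : τ a x - x = c) (k : ℕ) : τ (k • a) x - x = k * c := by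
  induction k with
  | zero => simp [hτ.zero_apply]
  | succ k ih =>
    rw [succ_nsmul, hτ.add, ← sub_add_cancel (τ a x) x, h, map_add, hc, Nat.cast_succ]
    linear_combination ih

/-- Second differences of a solution of the quadratic relation
`δ (4 g - δ² + 2 δ) = 0`, `δ = τ g - g`, vanish. -/
lemma apply_eq_of_quadratic [IsDomain B] [CharZero B] (hτ : IsTranslationAction τ) {g : B}
    (h : ∀ a, (τ a g - g) * (4 * g - (τ a g - g) ^ 2 + 2 * (τ a g - g)) = 0) (a : G) :
    τ a g = g := by
  by_contra hne
  -- If `τ a` moves `g`, so does `τ (a + a)`; hence the quadratic factor vanishes for both. Its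
  -- translate by `τ a` is a third equation.
  have hne2 : τ (a + a) g - g ≠ 0 := fun h0 => hne (hτ.two a g (sub_eq_zero.1 h0))
  have hne1 : τ a g - g ≠ 0 := sub_ne_zero.2 hne
  have h1 := (mul_eq_zero.1 (h a)).resolve_left hne1
  have h2 := (mul_eq_zero.1 (h (a + a))).resolve_left hne2
  rw [hτ.add] at h2 hne2
  set y := τ a g with hy
  set z := τ a y with hz
  have h3 : 4 * y - (z - y) ^ 2 + 2 * (z - y) = 0 := by
    have := congrArg (τ a) h1
    simpa only [map_add, map_sub, map_mul, map_pow, map_ofNat, map_zero, ← hy, ← hz] using this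
  have hback : ∀ x, τ (-a) (τ a x) = x := fun x => by
    rw [← hτ.add, neg_add_cancel, hτ.zero_apply]
  have hzy : z - y ≠ 0 := fun h0 => by
    have := congrArg (τ (-a)) (sub_eq_zero.1 h0)
    rw [hz, hback, hy, hback] at this
    exact hne this
  have h4 : z - y = 2 - 2 * (y - g) := by
    -- The difference of the two quadratics factors.
    have : (z - y) * ((z - y) - (2 - 2 * (y - g))) = 0 := by linear_combination h1 - h2
    exact sub_eq_zero.1 ((mul_eq_zero.1 this).resolve_left hzy)
  have h5 : y - g = 2 := by
    have : (y - g) * (3 * (y - g - 2)) = 0 := by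
      rw [h4] at h3
      linear_combination h1 - h3
    have := (mul_eq_zero.1 this).resolve_left hne1
    exact sub_eq_zero.1 ((mul_eq_zero.1 this).resolve_left (by norm_num))
  -- Translating `h5` gives `z - y = 2`, whereas `h4` and `h5` give `z - y = -2`.
  have h6 : z - y = 2 := by
    have := congrArg (τ a) h5
    simpa only [map_sub, map_ofNat, ← hy, ← hz] using this
  rw [h5, h6] at h4
  norm_num at h4

end IsTranslationAction

/-- Elimination of the operators `H`, `F` from the relations of a system in which `E` is
constant. -/
lemma quadratic_of_elimination {R : Type*} [CommRing R] [IsDomain R] [CharZero R]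
    -- Here `x` is the variable, `c` and `r` are the constants `E 0` and `E a`, and `g'` is `τ a g`.
    -- The letters `f`, `fa`, `k`, `y` stand for `F 0`, its image under `τ a`, `H a` and `F a`. The
    -- suffixes `2` and `4` mark translations by `2` and `4`; `fm` and `fp` are `fa` translated by
    -- `-2` and `2`.
    {x c r g g' f f2 f4 fa fm fp k k2 k4 y y2 : R} (hr : r ≠ 0)
    (hf : 4 * (c * f) = 4 * g - x ^ 2 - 2 * x)
    (hf2 : 4 * (c * f2) = 4 * g - (x + 2) ^ 2 - 2 * (x + 2))
    (hf4 : 4 * (c * f4) = 4 * g - (x + 2 + 2) ^ 2 - 2 * (x + 2 + 2))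
    (hfa : 4 * (c * fa) = 4 * g' - x ^ 2 - 2 * x)
    (hfm : 4 * (c * fm) = 4 * g' - (x + -2) ^ 2 - 2 * (x + -2))
    (hfp : 4 * (c * fp) = 4 * g' - (x + 2) ^ 2 - 2 * (x + 2))
    (hk : r * fm - f * r = k) (hk2 : r * fa - f2 * r = k2) (hk4 : r * fp - f4 * r = k4)
    (hy : k * fa - f * k2 = -(2 * y)) (hy2 : k2 * fp - f2 * k4 = -(2 * y2))
    (h : y * fp = f * y2) : (g' - g) * (4 * g - (g' - g) ^ 2 + 2 * (g' - g)) = 0 := by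
  -- Multiplication by `c` replaces each `F` by its Casimir expression; this makes `c * k` linear in
  -- `x`.
  have hK : c * k = r * (x + (g' - g)) := by
    refine mul_left_cancel₀ (show (4 : R) ≠ 0 by norm_num) ?_
    linear_combination -4 * c * hk + r * hfm - r * hf
  have hK2 : c * k2 = r * (x + 2 + (g' - g)) := by
    refine mul_left_cancel₀ (show (4 : R) ≠ 0 by norm_num) ?_
    linear_combination -4 * c * hk2 + r * hfa - r * hf2
  have hK4 : c * k4 = r * (x + 4 + (g' - g)) := by
    refine mul_left_cancel₀ (show (4 : R) ≠ 0 by norm_num) ?_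
    linear_combination -4 * c * hk4 + r * hfp - r * hf4
  have hY : c ^ 2 * (-8 * y) = r * ((x + (g' - g)) * (4 * g' - x ^ 2 - 2 * x)
      - (4 * g - x ^ 2 - 2 * x) * (x + 2 + (g' - g))) := by
    linear_combination -4 * c ^ 2 * hy + 4 * c * fa * hK + r * (x + (g' - g)) * hfa
      - 4 * c * f * hK2 - r * (x + 2 + (g' - g)) * hf
  have hY2 : c ^ 2 * (-8 * y2)
      = r * ((x + 2 + (g' - g)) * (4 * g' - (x + 2) ^ 2 - 2 * (x + 2))
      - (4 * g - (x + 2) ^ 2 - 2 * (x + 2)) * (x + 4 + (g' - g))) := by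
    linear_combination -4 * c ^ 2 * hy2 + 4 * c * fp * hK2 + r * (x + 2 + (g' - g)) * hfp
      - 4 * c * f2 * hK4 - r * (x + 4 + (g' - g)) * hf2
  have h' : r * (((x + (g' - g)) * (4 * g' - x ^ 2 - 2 * x)
      - (4 * g - x ^ 2 - 2 * x) * (x + 2 + (g' - g)))
        * (4 * g' - (x + 2) ^ 2 - 2 * (x + 2))
      - (4 * g - x ^ 2 - 2 * x) * ((x + 2 + (g' - g)) * (4 * g' - (x + 2) ^ 2 - 2 * (x + 2))
      - (4 * g - (x + 2) ^ 2 - 2 * (x + 2)) * (x + 4 + (g' - g)))) = 0 := by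
    linear_combination -32 * c ^ 3 * h - 4 * c * fp * hY
      - r * ((x + (g' - g)) * (4 * g' - x ^ 2 - 2 * x)
      - (4 * g - x ^ 2 - 2 * x) * (x + 2 + (g' - g))) * hfp
      + 4 * c * f * hY2
      + r * ((x + 2 + (g' - g)) * (4 * g' - (x + 2) ^ 2 - 2 * (x + 2))
      - (4 * g - (x + 2) ^ 2 - 2 * (x + 2)) * (x + 4 + (g' - g))) * hf
  have h'' := (mul_eq_zero.1 h').resolve_left hr
  -- All powers of `x` cancel in `h''`, leaving `-16` times the required expression.
  refine mul_left_cancel₀ (show (16 : R) ≠ 0 by norm_num) ?_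
  linear_combination -h''

namespace LoopSl2System

variable {G B : Type*} [AddCommGroup G] [CommRing B] {τ : G → B →+* B} {E F H : G → B[X]}

/-- The Chevalley involution. -/
lemma symm (S : LoopSl2System τ E F H) :
    LoopSl2System τ (fun a => (F a).comp (-X)) (fun a => (E a).comp (-X))
      (fun a => -(H a).comp (-X)) := by
  have key : ∀ (s : B) (p : B[X]), taylor s (p.comp (-X)) = (taylor (-s) p).comp (-X) := by
    intro s p
    simp only [taylor_apply, comp_assoc]
    congr 1
    simp [add_comm]
  have key2 : ∀ (a : G) (p : B[X]), (p.comp (-X)).map (τ a) = (p.map (τ a)).comp (-X) := by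
    intro a p
    simp [Polynomial.map_comp]
  constructor
  · simp [S.h_zero]
  · intro a b
    have := congrArg (fun p => p.comp (-X)) (S.hf a b)
    simp only [sub_comp, mul_comp, neg_comp, ofNat_comp] at this
    simp only [Polynomial.map_neg, key, key2, map_neg, neg_neg]
    linear_combination -this
  · intro a b
    have := congrArg (fun p => p.comp (-X)) (S.he a b)
    simp only [sub_comp, mul_comp, ofNat_comp] at this
    simp only [Polynomial.map_neg, key, key2, map_neg]
    linear_combination -this
  · intro a
    have := congrArg (fun p => p.comp (-X)) (S.ef_right a)
    simp only [sub_comp, mul_comp] at this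
    simp only [key, key2, neg_neg]
    linear_combination -this
  · intro a
    have := congrArg (fun p => p.comp (-X)) (S.ef_left a)
    simp only [sub_comp, mul_comp] at this
    simp only [key, key2, neg_neg]
    linear_combination -this
  · intro a
    have := congrArg (fun p => p.comp (-X)) (S.ff a)
    simp only [mul_comp] at this
    simp only [key, key2, neg_neg]
    exact this
  · intro a
    have := congrArg (fun p => p.comp (-X)) (S.ee a)
    simp only [mul_comp] at this
    simp only [key, key2]
    exact this

variable (S : LoopSl2System τ E F H) (hτ : IsTranslationAction τ)
include S hτ

lemma ef_zero : E 0 * taylor (-2) (F 0) - F 0 * taylor 2 (E 0) = X := by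
  simpa [hτ.zero, S.h_zero] using S.ef_left 0

variable [IsDomain B] [CharZero B] [Algebra ℂ B]

/-- The Casimir element acts on `B[X]` by a scalar from `B`. -/
lemma exists_casimir :
    ∃ g : B, 4 * (taylor 2 (E 0) * F 0) = C (4 * g) - X ^ 2 - 2 * X := by
  have h := S.ef_zero hτ
  -- Invariance under `X ↦ X - 2` is four times the relation `[e, f] = h`.
  obtain ⟨r, hr⟩ := eq_C_of_taylor_eq (s := (-2 : B)) (by simp)
    (p := 4 * (taylor 2 (E 0) * F 0) + X ^ 2 + 2 * X) (by
      have h2 : taylor (-2 : B) (2 : B[X]) = 2 := taylor_C (R := B) (-2) 2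
      have h4 : taylor (-2 : B) (4 : B[X]) = 4 := taylor_C (R := B) (-2) 4
      simp only [map_add, taylor_mul, taylor_pow, taylor_X, taylor_taylor, neg_add_cancel,
        taylor_zero, h2, h4, C_neg]
      rw [show (C (2 : B)) = 2 from rfl]
      linear_combination 4 * h)
  obtain ⟨c, hc⟩ : ∃ c : B, 4 * c = 1 :=
    ⟨algebraMap ℂ B 4⁻¹, by rw [← map_ofNat (algebraMap ℂ B) 4, ← map_mul]; simp⟩
  refine ⟨c * r, ?_⟩
  rw [← mul_assoc 4 c r, hc, one_mul]
  linear_combination hr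

/-- The Casimir relation has a right-hand side of degree `2` with leading coefficient `-1`, and over
a domain degrees add and leading coefficients multiply. -/
lemma isUnit_leadingCoeff_and_natDegree_add :
    IsUnit (E 0).leadingCoeff ∧ IsUnit (F 0).leadingCoeff ∧
      (E 0).natDegree + (F 0).natDegree = 2 := by
  obtain ⟨g, hg⟩ := S.exists_casimir hτ
  have hq : C (4 * g) - X ^ 2 - 2 * X = C (-1) * X ^ 2 + C (-2) * X + C (4 * g) := by
    simp only [C_neg, C_1]
    rw [show (C (2 : B)) = 2 from rfl]
    ring
  have hdeg : (4 * (taylor 2 (E 0) * F 0)).natDegree = 2 := by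
    rw [hg, hq, natDegree_quadratic (by simp)]
  have hlc : (4 * (taylor 2 (E 0) * F 0)).leadingCoeff = -1 := by
    rw [hg, hq, leadingCoeff_quadratic (by simp)]
  rw [show (4 : B[X]) = C 4 from rfl] at hdeg hlc
  rw [leadingCoeff_mul, leadingCoeff_mul, leadingCoeff_C, leadingCoeff_taylor] at hlc
  have hE : E 0 ≠ 0 := fun h => by simp [h] at hlc
  have hF : F 0 ≠ 0 := fun h => by simp [h] at hlc
  rw [natDegree_C_mul (by simp), natDegree_mul (by simpa using hE) hF, natDegree_taylor] at hdeg
  refine ⟨IsUnit.of_mul_eq_one (-4 * (F 0).leadingCoeff) ?_,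
    IsUnit.of_mul_eq_one (-4 * (E 0).leadingCoeff) ?_, hdeg⟩ <;> linear_combination -hlc

/-- Because `[h(-a), e(a)] = 2 e(0)`, vanishing of `E a` would force `E 0 = 0`. -/
lemma E_ne_zero (a : G) : E a ≠ 0 := by
  intro h
  have h' := S.he (-a) a
  rw [h, neg_add_cancel] at h'
  have h0 : E 0 = 0 := by simpa using h'
  simpa [h0] using (S.isUnit_leadingCoeff_and_natDegree_add hτ).1

/-- The coefficient of `E 0` below the leading one is invariant. -/
lemma map_nextCoeff_E (a : G) : τ a (E 0).nextCoeff = (E 0).nextCoeff := by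
  obtain ⟨hu, -, -⟩ := S.isUnit_leadingCoeff_and_natDegree_add hτ
  have hne := fun a => S.E_ne_zero hτ a
  have key : ∀ a, τ a (E 0).nextCoeff - (E 0).nextCoeff
      = ((E a).natDegree - (E 0).natDegree : B) * (-2) * (E 0).leadingCoeff := fun a =>
    nextCoeff_of_mul_taylor_eq (τ a) (-2) (hne a) (hne 0) (hτ.unit a _ hu) (S.ee a)
  have hsmul : ∀ (a : G) (k : ℕ), ((E (k • a)).natDegree : ℤ) - (E 0).natDegree
      = k * ((E a).natDegree - (E 0).natDegree) := by
    intro a k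
    have h1 := hτ.apply_nsmul_sub (fun b => by
      simp only [map_mul, map_sub, map_natCast, map_neg, map_ofNat, hτ.unit b _ hu]) (key a) k
    rw [key (k • a)] at h1
    have h2 : (((E (k • a)).natDegree : B) - (E 0).natDegree
        - k * ((E a).natDegree - (E 0).natDegree)) * (-2 * (E 0).leadingCoeff) = 0 := by
      linear_combination h1
    have h3 := (mul_eq_zero.1 h2).resolve_right (by simpa using hne 0)
    have h4 := sub_eq_zero.1 h3
    exact_mod_cast h4
  have hle : ∀ a, (E 0).natDegree ≤ (E a).natDegree := by
    intro a
    by_contra! hlt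
    -- A defect of at most `-1`, taken `(E 0).natDegree + 1` times, would produce a negative degree.
    have := hsmul a ((E 0).natDegree + 1)
    push_cast at this
    nlinarith
  -- Applying `τ a` to the relation for `-a` shows that the defects at `a` and `-a` are opposite;
  -- both are nonnegative by `hle`.
  have hneg : ((E a).natDegree : ℤ) - (E 0).natDegree
      = -((E (-a)).natDegree - (E 0).natDegree) := by
    have h1 := key a
    have h2 := congrArg (τ a) (key (-a))
    rw [map_sub, ← hτ.add, add_neg_cancel, hτ.zero_apply] at h2
    simp only [map_mul, map_sub, map_natCast, map_neg, map_ofNat, hτ.unit a _ hu] at h2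
    have h3 : (((E a).natDegree : B) - (E 0).natDegree
        + ((E (-a)).natDegree - (E 0).natDegree)) * (-2 * (E 0).leadingCoeff) = 0 := by
      linear_combination -h1 - h2
    have h4 := (mul_eq_zero.1 h3).resolve_right (by simpa using hne 0)
    have h5 := eq_neg_of_add_eq_zero_left h4
    exact_mod_cast h5
  have heq : (E a).natDegree = (E 0).natDegree := by
    have := hle a
    have := hle (-a)
    omega
  have := key a
  rw [heq, sub_self, zero_mul, zero_mul] at this
  exact sub_eq_zero.1 this

/-- In degree at most one there are only two coefficients: the leading one is a unit, hence fixed,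
and the other is covered by `map_nextCoeff_E`. -/
lemma map_E_of_natDegree_le_one (h : (E 0).natDegree ≤ 1) (a : G) : (E 0).map (τ a) = E 0 := by
  obtain ⟨hu, -, -⟩ := S.isUnit_leadingCoeff_and_natDegree_add hτ
  have h1 := hτ.unit a _ hu
  have h2 := S.map_nextCoeff_E hτ a
  ext k
  rw [coeff_map]
  rcases lt_or_ge (E 0).natDegree k with hk | hk
  · simp [coeff_eq_zero_of_natDegree_lt hk]
  rcases hk.eq_or_lt with rfl | hk
  · exact h1
  · rw [nextCoeff_of_natDegree_pos (by omega)] at h2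
    obtain rfl : k = (E 0).natDegree - 1 := by omega
    exact h2

/-- If `E 0` is constant, then the Casimir scalar is invariant. -/
lemma map_F_of_natDegree_eq_zero (h : (E 0).natDegree = 0) (a : G) : (F 0).map (τ a) = F 0 := by
  obtain ⟨hu, -, -⟩ := S.isUnit_leadingCoeff_and_natDegree_add hτ
  obtain ⟨c, hc⟩ := natDegree_eq_zero.1 h
  rw [← hc, leadingCoeff_C] at hu
  have hcE : ∀ a, (E 0).map (τ a) = E 0 := S.map_E_of_natDegree_le_one hτ (by omega)
  obtain ⟨g, hg⟩ := S.exists_casimir hτ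
  have hc0 : c ≠ 0 := hu.ne_zero
  rw [← hc, taylor_C] at hg
  have hmap : ∀ a, 4 * (C c * (F 0).map (τ a)) = C (4 * τ a g) - X ^ 2 - 2 * X := by
    intro a
    have := congrArg (Polynomial.map (τ a)) hg
    simpa only [Polynomial.map_mul, Polynomial.map_sub, Polynomial.map_pow, Polynomial.map_ofNat,
      map_C, map_X, map_mul, map_ofNat, hτ.unit a c hu] using this
  have t2 : ∀ (s : B), taylor s (2 : B[X]) = 2 := fun s => taylor_C (R := B) s 2
  have t4 : ∀ (s : B), taylor s (4 : B[X]) = 4 := fun s => taylor_C (R := B) s 4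
  have hinv : ∀ a, τ a g = g := by
    refine hτ.apply_eq_of_quadratic fun a => ?_
    -- As `E 0` is an invariant constant, `[e(a), e(0)] = 0` makes `E a` invariant under translation
    -- of the variable, hence constant.
    have hee : E a * C c = C c * taylor (-2) (E a) := by
      have := S.ee a
      rwa [hcE, ← hc, taylor_C] at this
    have hra : ∃ r, E a = C r := by
      refine eq_C_of_taylor_eq (s := (-2 : B)) (by simp) ?_
      refine mul_left_cancel₀ (C_ne_zero.2 hc0) ?_
      linear_combination -hee
    obtain ⟨r, hr⟩ := hra
    have hr0 : r ≠ 0 := fun h0 => S.E_ne_zero hτ a (by simp [hr, h0])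
    -- Translates of the Casimir relation, of `[e(a), f(0)] = h(a)` and of `[h(a), f(0)] = -2 f(a)`
    -- are collected for the elimination.
    have hG := hg
    have hGa := hmap a
    have hGm := congrArg (taylor (-2)) hGa
    have hGp := congrArg (taylor 2) hGa
    have hG0 := congrArg (taylor 2) hG
    have hG4 := congrArg (taylor 2) hG0
    simp only [map_sub, taylor_mul, taylor_pow, taylor_C, t2, t4, taylor_X, C_neg]
      at hGm hGp hG0 hG4
    have hH := S.ef_left a
    rw [hr, taylor_C] at hH
    have hH2 := congrArg (taylor 2) hH
    simp only [map_sub, taylor_mul, taylor_C, taylor_taylor, add_neg_cancel, taylor_zero] at hH2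
    have hH4 := congrArg (taylor 2) hH2
    simp only [map_sub, taylor_mul, taylor_C] at hH4
    have hF := S.hf a 0
    rw [hτ.zero, Polynomial.map_id, add_zero] at hF
    have hF2 := congrArg (taylor 2) hF
    simp only [map_sub, map_neg, taylor_mul, t2, taylor_taylor] at hF2
    have hff := S.ff a
    have h2C : (C (2 : B) : B[X]) = 2 := rfl
    have h4C : (C (4 : B) : B[X]) = 4 := rfl
    simp only [C_mul, h2C, h4C, map_add, taylor_X] at hG hGa hGm hGp hG0 hG4
    simp only [taylor_taylor, t2] at hG4 hH4
    generalize taylor (-2) ((F 0).map (τ a)) = fm at *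
    generalize taylor 2 ((F 0).map (τ a)) = fp at *
    generalize taylor (2 + 2) (F 0) = f4 at *
    generalize taylor 2 (F 0) = f2 at *
    generalize taylor (2 + 2) (H a) = H4 at *
    generalize taylor 2 (H a) = H2 at *
    generalize taylor 2 (F a) = Fa2 at *
    generalize (F 0).map (τ a) = fa at *
    generalize F 0 = f at *
    generalize F a = Fa at *
    generalize H a = Ha at *
    have := quadratic_of_elimination (C_ne_zero.2 hr0) hG hG0 hG4 hGa hGm hGp
      hH hH2 hH4 hF hF2 hff
    refine C_injective ?_
    simpa only [C_mul, C_sub, C_add, C_pow, h4C, h2C, C_0] using this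
  exact mul_left_cancel₀ (C_ne_zero.2 hc0)
    (mul_left_cancel₀ (by norm_num) ((hmap a).trans (by rw [hinv a, ← hg])))

/-- The degrees of `E 0` and `F 0` are `(0, 2)`, `(1, 1)` or `(2, 0)`; the Chevalley involution
`symm` exchanges the two families, so the results for small degree of `E 0` cover every case. -/
lemma map_E_and_map_F (a : G) : (E 0).map (τ a) = E 0 ∧ (F 0).map (τ a) = F 0 := by
  have hF : (F 0).natDegree = ((F 0).comp (-X)).natDegree := by simp [natDegree_comp]
  have hneg : ∀ p : B[X], (p.comp (-X)).comp (-X) = p := fun p => by simp [comp_assoc]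
  have hpull : ∀ p : B[X], (p.comp (-X)).map (τ a) = p.comp (-X) → p.map (τ a) = p := by
    intro p h
    have := congrArg (fun q => q.comp (-X)) h
    rw [Polynomial.map_comp] at this
    simpa [hneg] using this
  obtain ⟨-, -, hdeg⟩ := S.isUnit_leadingCoeff_and_natDegree_add hτ
  rcases Nat.lt_or_ge (E 0).natDegree 1 with hE | hE
  · exact ⟨S.map_E_of_natDegree_le_one hτ (by omega) a,
      S.map_F_of_natDegree_eq_zero hτ (by omega) a⟩
  · refine ⟨?_, hpull _ (S.symm.map_E_of_natDegree_le_one hτ (by omega) a)⟩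
    rcases Nat.lt_or_ge (F 0).natDegree 1 with hF0 | hF0
    · exact hpull _ (S.symm.map_F_of_natDegree_eq_zero hτ (by omega) a)
    · exact S.map_E_of_natDegree_le_one hτ (by omega) a

/-- The structure polynomials are determined by those of `𝔰𝔩₂`, which do not involve the degree
derivations, up to a character of the grading group. -/
theorem exists_character :
    (∀ a, (E 0).map (τ a) = E 0) ∧ (∀ a, (F 0).map (τ a) = F 0) ∧
    ∃ r : G → B, (∀ a, IsUnit (r a)) ∧ (∀ a b, r (a + b) = r a * r b) ∧
      ∀ a, E a = C (r a) * E 0 ∧ F a = C (r a) * F 0 ∧ H a = C (r a) * X := by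
  have hE : ∀ a, (E 0).map (τ a) = E 0 := fun a => (S.map_E_and_map_F hτ a).1
  have hF : ∀ a, (F 0).map (τ a) = F 0 := fun a => (S.map_E_and_map_F hτ a).2
  obtain ⟨huE, huF, -⟩ := S.isUnit_leadingCoeff_and_natDegree_add hτ
  have hE0 := S.E_ne_zero hτ 0
  -- Invariance of `E 0` turns `ee` into the statement that `E a / E 0` is fixed by a translation of
  -- the variable.
  choose r hr using fun a => eq_C_mul_of_mul_taylor_eq (s := (-2 : B)) (by simp) huE
    (p := E a) (by simpa [hE] using S.ee a)
  choose s hs using fun a => eq_C_mul_of_mul_taylor_eq (s := (2 : B)) (by simp) huF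
    (p := F a) (by simpa [hF] using S.ff a)
  have h0 := S.ef_zero hτ
  have hHr : ∀ a, H a = C (r a) * X := by
    intro a
    rw [← S.ef_left a, hr a, hF, taylor_mul, taylor_C]
    linear_combination C (r a) * h0
  have hHs : ∀ a, H a = C (s a) * X := by
    intro a
    rw [← S.ef_right a, hs a, hE, taylor_mul, taylor_C]
    linear_combination C (s a) * h0
  have hrs : ∀ a, s a = r a := fun a =>
    C_injective (mul_right_cancel₀ X_ne_zero ((hHs a).symm.trans (hHr a)))
  have hmul : ∀ a b, r a * τ a (r b) = r (a + b) := by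
    intro a b
    have h1 := S.he a b
    rw [hr (a + b), hHr a, hr b] at h1
    simp only [Polynomial.map_mul, map_C, map_X, taylor_mul, taylor_C, taylor_X, hE, C_neg] at h1
    have h2 : C (r a) * C (τ a (r b)) * X - C (r b) * C (τ b (r a)) * (X + -C 2)
        = 2 * C (r (a + b)) := mul_right_cancel₀ hE0 (by linear_combination h1)
    have h3 := congrArg (fun p => eval 0 p) h2
    -- At `X = 2` the second product vanishes.
    have h4 := congrArg (fun p => eval 2 p) h2
    simp only [eval_sub, eval_mul, eval_C, eval_X, eval_add, eval_neg, eval_ofNat] at h3 h4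
    refine mul_right_cancel₀ (two_ne_zero (α := B)) ?_
    linear_combination h4
  have hr0 : r 0 = 1 := by
    have := hHr 0
    rw [S.h_zero] at this
    exact C_injective (mul_right_cancel₀ X_ne_zero (by rw [← this, C_1, one_mul]))
  have hu : ∀ a, IsUnit (r a) := fun a =>
    IsUnit.of_mul_eq_one _ ((hmul a (-a)).trans (by rw [add_neg_cancel, hr0]))
  -- The twisted multiplicativity `hmul` becomes multiplicativity because units are fixed by `τ`.
  exact ⟨hE, hF, r, hu, fun a b => by rw [← hmul, hτ.unit a _ (hu b)],
    fun a => ⟨hr a, by rw [hs a, hrs], hHr a⟩⟩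

end LoopSl2System

end

noncomputable section

/-! ### Enveloping algebras of abelian Lie algebras. -/

namespace UniversalEnvelopingAlgebra

section

attribute [local instance] LieRing.ofAssociativeRing

variable {𝔟 : Type*} [LieRing 𝔟] [LieAlgebra ℂ 𝔟]

local notation "U" => UniversalEnvelopingAlgebra ℂ 𝔟

/-- The lift of `ι` to `S`, followed by the inclusion, is the identity by the universal property.
The lemma serves as an induction principle for the enveloping algebra. -/
lemma eq_top_of_range_ι_le (S : Subalgebra ℂ U) (h : ∀ x, ι ℂ x ∈ S) : S = ⊤ := by
  let f : 𝔟 →ₗ⁅ℂ⁆ S :=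
    { toFun := fun x => ⟨ι ℂ x, h x⟩
      map_add' := fun x y => Subtype.ext (map_add _ x y)
      map_smul' := fun r x => Subtype.ext (map_smul _ r x)
      map_lie' := fun {x y} => Subtype.ext ((ι ℂ).map_lie x y) }
  have hf : S.val.comp (lift ℂ f) = AlgHom.id ℂ U := by
    ext x
    change ((lift ℂ f (ι ℂ x) : S) : U) = ι ℂ x
    rw [lift_ι_apply]
    rfl
  refine eq_top_iff.2 fun u _ => ?_
  have := AlgHom.congr_fun hf u
  rw [AlgHom.id_apply] at this
  rw [← this]
  exact (lift ℂ f u).2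

lemma algHom_ext_ι {A : Type*} [Ring A] [Algebra ℂ A] {f g : U →ₐ[ℂ] A}
    (h : ∀ x, f (ι ℂ x) = g (ι ℂ x)) : f = g := by
  refine AlgHom.ext fun u => ?_
  have : AlgHom.equalizer f g = ⊤ := eq_top_of_range_ι_le _ h
  exact (this ▸ Algebra.mem_top : u ∈ AlgHom.equalizer f g)

variable [IsLieAbelian 𝔟]

lemma commute_ι (x y : 𝔟) : Commute (ι ℂ x : U) (ι ℂ y) := by
  have := (ι ℂ).map_lie x y
  rw [trivial_lie_zero, map_zero, LieRing.of_associative_ring_bracket] at this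
  exact (sub_eq_zero.1 this.symm)

/-- Generators commute, so the centralizer of a generator is everything; hence the centralizer of
any element contains the generators. -/
lemma mul_comm_of_isLieAbelian (u v : U) : u * v = v * u := by
  have h1 : ∀ y : 𝔟, ∀ u : U, ι ℂ y * u = u * ι ℂ y := by
    intro y u
    have : Subalgebra.centralizer ℂ {(ι ℂ y : U)} = ⊤ :=
      eq_top_of_range_ι_le _ fun x => by
        rw [Subalgebra.mem_centralizer_iff]
        rintro _ rfl
        exact commute_ι y x
    have hu : u ∈ Subalgebra.centralizer ℂ {(ι ℂ y : U)} := this ▸ Algebra.mem_top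
    exact (Subalgebra.mem_centralizer_iff ℂ).1 hu _ rfl
  have : Subalgebra.centralizer ℂ {u} = ⊤ :=
    eq_top_of_range_ι_le _ fun x => by
      rw [Subalgebra.mem_centralizer_iff]
      rintro _ rfl
      exact (h1 x _).symm
  have hv : v ∈ Subalgebra.centralizer ℂ {u} := this ▸ Algebra.mem_top
  exact (Subalgebra.mem_centralizer_iff ℂ).1 hv _ rfl

/-- The enveloping algebra of an abelian Lie algebra is commutative. -/
abbrev commRing : CommRing U := { (inferInstance : Ring U) with mul_comm := mul_comm_of_isLieAbelian }

/-- Extension of a linear map with values in a commutative algebra to the enveloping algebra of an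
abelian Lie algebra. -/
def liftLinear {A : Type*} [Ring A] [Algebra ℂ A] (f : 𝔟 →ₗ[ℂ] A)
    (hf : ∀ x y, f x * f y = f y * f x) : U →ₐ[ℂ] A :=
  lift ℂ { f with
    map_lie' := fun {x y} => by
      change f ⁅x, y⁆ = ⁅f x, f y⁆
      rw [trivial_lie_zero, map_zero, LieRing.of_associative_ring_bracket, hf, sub_self] }

@[simp] lemma liftLinear_ι {A : Type*} [Ring A] [Algebra ℂ A] (f : 𝔟 →ₗ[ℂ] A)
    (hf : ∀ x y, f x * f y = f y * f x) (x : 𝔟) : liftLinear f hf (ι ℂ x) = f x :=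
  lift_ι_apply _ _ _

/-- The translation `x ↦ x - χ(x)` of the enveloping algebra of an abelian Lie algebra. -/
def weightShift (χ : Module.Dual ℂ 𝔟) : U →ₐ[ℂ] U :=
  liftLinear ((ι ℂ : 𝔟 →ₗ⁅ℂ⁆ U).toLinearMap - (Algebra.linearMap ℂ U).comp χ)
    fun _ _ => mul_comm_of_isLieAbelian _ _

@[simp] lemma weightShift_ι (χ : Module.Dual ℂ 𝔟) (x : 𝔟) :
    weightShift χ (ι ℂ x) = ι ℂ x - algebraMap ℂ U (χ x) := by
  rw [weightShift, liftLinear_ι]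
  rfl

lemma weightShift_zero (u : U) : weightShift (0 : Module.Dual ℂ 𝔟) u = u := by
  have : weightShift (0 : Module.Dual ℂ 𝔟) = AlgHom.id ℂ U := algHom_ext_ι fun x => by
    rw [weightShift_ι, LinearMap.zero_apply, map_zero, sub_zero, AlgHom.id_apply]
  rw [this]; rfl

/-- The enveloping algebra of an abelian Lie algebra with a basis is a polynomial algebra. -/
def equivMvPolynomial {κ : Type*} (v : Module.Basis κ ℂ 𝔟) : U ≃ₐ[ℂ] MvPolynomial κ ℂ :=
  letI := commRing (𝔟 := 𝔟)
  AlgEquiv.ofAlgHom (liftLinear (v.constr ℂ MvPolynomial.X) fun _ _ => mul_comm _ _)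
    (MvPolynomial.aeval fun k => ι ℂ (v k))
    (MvPolynomial.algHom_ext fun k => by
      rw [AlgHom.comp_apply, MvPolynomial.aeval_X, liftLinear_ι, Module.Basis.constr_basis]
      rfl)
    (algHom_ext_ι fun x => by
      simp only [AlgHom.comp_apply, liftLinear_ι, AlgHom.id_apply]
      have : (MvPolynomial.aeval (R := ℂ) fun k => (ι ℂ (v k) : U)).toLinearMap.comp
          (v.constr ℂ (MvPolynomial.X (R := ℂ))) = (ι ℂ : 𝔟 →ₗ⁅ℂ⁆ U).toLinearMap :=
        v.ext fun k => by
          simp only [LinearMap.comp_apply, Module.Basis.constr_basis, AlgHom.toLinearMap_apply,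
            MvPolynomial.aeval_X]
          rfl
      exact LinearMap.congr_fun this x)

lemma equivMvPolynomial_ι {κ : Type*} (v : Module.Basis κ ℂ 𝔟) (k : κ) :
    equivMvPolynomial v (ι ℂ (v k)) = MvPolynomial.X k := by
  change liftLinear (v.constr ℂ (MvPolynomial.X (R := ℂ))) (fun _ _ => mul_comm _ _)
    (ι ℂ (v k)) = _
  rw [liftLinear_ι, Module.Basis.constr_basis]

end

section

variable {𝔞 : Type*} [LieRing 𝔞] [LieAlgebra ℂ 𝔞] (𝔟 : LieSubalgebra ℂ 𝔞)
  (N : Type*) [AddCommGroup N] [Module ℂ N] [LieRingModule 𝔞 N] [LieModule ℂ 𝔞 N]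

attribute [local instance] LieRing.ofAssociativeRing

/-- The action of `U(𝔟)` on an `𝔞`-module. -/
def act : UniversalEnvelopingAlgebra ℂ 𝔟 →ₐ[ℂ] Module.End ℂ N :=
  UniversalEnvelopingAlgebra.lift ℂ ((LieModule.toEnd ℂ 𝔞 N).comp 𝔟.incl)

variable {N}

@[simp] lemma act_ι (x : 𝔟) (v : N) : act 𝔟 N (ι ℂ x) v = ⁅(x : 𝔞), v⁆ := by
  rw [act, lift_ι_apply]
  rfl

variable {𝔟} [IsLieAbelian 𝔟]

/-- A vector of weight `χ` commutes with `U(𝔟)` up to the translation by `χ`. -/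
lemma lie_act {x : 𝔞} {χ : Module.Dual ℂ 𝔟} (hx : ∀ y : 𝔟, ⁅(y : 𝔞), x⁆ = χ y • x)
    (u : UniversalEnvelopingAlgebra ℂ 𝔟) (v : N) :
    ⁅x, act 𝔟 N u v⁆ = act 𝔟 N (weightShift χ u) ⁅x, v⁆ := by
  let S : Subalgebra ℂ (UniversalEnvelopingAlgebra ℂ 𝔟) :=
    { carrier := {u | ∀ v : N, ⁅x, act 𝔟 N u v⁆ = act 𝔟 N (weightShift χ u) ⁅x, v⁆}
      mul_mem' := fun {a b} ha hb v => by
        rw [map_mul, map_mul, map_mul, Module.End.mul_apply, Module.End.mul_apply, ha, hb]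
      add_mem' := fun {a b} ha hb v => by
        rw [map_add, map_add, map_add, LinearMap.add_apply, LinearMap.add_apply, lie_add, ha, hb]
      algebraMap_mem' := fun r v => by
        rw [AlgHom.commutes, AlgHom.commutes, AlgHom.commutes]
        simp [Module.algebraMap_end_apply] }
  have : S = ⊤ := eq_top_of_range_ι_le S fun y v => by
    rw [weightShift_ι, map_sub, LinearMap.sub_apply, act_ι, act_ι, AlgHom.commutes,
      Module.algebraMap_end_apply, leibniz_lie, ← lie_skew, hx, neg_lie, smul_lie]
    abel
  exact (this ▸ Algebra.mem_top : u ∈ S) v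

end

end UniversalEnvelopingAlgebra

open UniversalEnvelopingAlgebra in
/-- It suffices to check equivariance on generators of `U(𝔟)`. -/
lemma isFreeRankOne_of_equiv {𝔞 : Type*} [LieRing 𝔞] [LieAlgebra ℂ 𝔞] {𝔟 : LieSubalgebra ℂ 𝔞}
    {N : Type*} [AddCommGroup N] [Module ℂ N] [LieRingModule 𝔞 N] [LieModule ℂ 𝔞 N]
    (e : N ≃ₗ[ℂ] UniversalEnvelopingAlgebra ℂ 𝔟)
    (he : ∀ (x : 𝔟) (v : N), e ⁅(x : 𝔞), v⁆ = ι ℂ x * e v) : IsFreeRankOne 𝔟 N := by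
  refine ⟨e, fun u v => ?_⟩
  change e (act 𝔟 N u v) = u * e v
  let S : Subalgebra ℂ (UniversalEnvelopingAlgebra ℂ 𝔟) :=
    { carrier := {u | ∀ v : N, e (act 𝔟 N u v) = u * e v}
      mul_mem' := fun {a b} ha hb v => by
        rw [map_mul, Module.End.mul_apply, ha, hb, mul_assoc]
      add_mem' := fun {a b} ha hb v => by
        rw [map_add, LinearMap.add_apply, map_add, ha, hb, add_mul]
      algebraMap_mem' := fun r v => by
        rw [AlgHom.commutes, Module.algebraMap_end_apply, map_smul, Algebra.smul_def] }
  have : S = ⊤ := eq_top_of_range_ι_le S fun x v => by rw [act_ι, he]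
  exact (this ▸ Algebra.mem_top : u ∈ S) v

end

noncomputable section

/-! ### Brackets, spanning set and Cartan subalgebra of the toroidal algebra. -/

namespace ToroidalAlgebra

variable {n : ℕ} {𝔤 : Type*} [LieRing 𝔤] [LieAlgebra ℂ 𝔤]

lemma elt_add (x y : 𝔤) (a : Fin n → ℤ) : elt (x + y) a = elt x a + elt y a := by
  ext1 <;> simp [elt, loopElt, TensorProduct.tmul_add]

lemma elt_smul (r : ℂ) (x : 𝔤) (a : Fin n → ℤ) : elt (r • x) a = r • elt x a := by
  ext1 <;> simp [elt, loopElt]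

/-- The element `∑ᵢ cᵢ dᵢ` of `D`. -/
def degElt (c : Fin n → ℂ) : ToroidalAlgebra n 𝔤 := ⟨0, 0, c⟩

lemma degElt_eq_sum (c : Fin n → ℂ) :
    (degElt c : ToroidalAlgebra n 𝔤) = ∑ i, c i • der i := by
  let f : (Fin n → ℂ) →ₗ[ℂ] ToroidalAlgebra n 𝔤 :=
    { toFun := degElt
      map_add' := fun c c' => by ext1 <;> simp [degElt]
      map_smul' := fun r c => by ext1 <;> simp [degElt] }
  have hc : c = ∑ i, c i • Pi.single i (1 : ℂ) := by
    ext j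
    simp [Finset.sum_apply, Pi.single_apply]
  have := congrArg f hc
  rw [map_sum] at this
  simp only [map_smul] at this
  exact this

lemma degElt_lie_elt (c : Fin n → ℂ) (x : 𝔤) (a : Fin n → ℤ) :
    ⁅(degElt c : ToroidalAlgebra n 𝔤), elt x a⁆ = pairing c a • elt x a := by
  ext1
  · simp [degElt, elt, loopElt, degLoop_zero, TensorProduct.smul_tmul']
  · simp [degElt, elt]
  · simp [degElt, elt]

lemma elt_lie_elt_of_zero_left (x y : 𝔤) (b : Fin n → ℤ) :
    ⁅(elt x 0 : ToroidalAlgebra n 𝔤), elt y b⁆ = elt ⁅x, y⁆ b := by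
  rw [elt_lie_elt]; simp

lemma elt_zero_vec (a : Fin n → ℤ) : (elt (0 : 𝔤) a : ToroidalAlgebra n 𝔤) = 0 := by
  ext1 <;> simp [elt, loopElt]

/-- The sum is the class of `d(t^a)`. Skew-symmetry of `formPair` moves the differential onto `t^0`,
where it vanishes. -/
lemma sum_smul_central (a : Fin n → ℤ) :
    ∑ i, (a i : ℂ) • (central a i : ToroidalAlgebra n 𝔤) = 0 := by
  let f : KA n →ₗ[ℂ] ToroidalAlgebra n 𝔤 :=
    { toFun := fun k => ⟨0, k, 0⟩
      map_add' := fun c c' => by ext1 <;> simp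
      map_smul' := fun r c => by ext1 <;> simp }
  change ∑ i, (a i : ℂ) • f (tK a i) = 0
  simp only [← map_smul, ← map_sum]
  have : ∑ i, (a i : ℂ) • tK a i = formPair n (mono a) (mono 0) := by
    rw [formPair_mono, add_zero]
  rw [this, eq_neg_of_add_eq_zero_left (formPair_add_swap _ _), formPair_mono]
  simp

lemma elt_lie_elt_of_zero_right (x y : 𝔤) (a : Fin n → ℤ) :
    ⁅(elt x a : ToroidalAlgebra n 𝔤), elt y 0⁆ = elt ⁅x, y⁆ a := by
  rw [elt_lie_elt, add_zero, sum_smul_central, smul_zero, add_zero]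

/-- The toroidal Lie algebra is spanned by the elements `x(a)`, `t^a Kⱼ` and `dᵢ`. -/
lemma submodule_eq_top (S : Submodule ℂ (ToroidalAlgebra n 𝔤)) (h1 : ∀ x a, elt x a ∈ S)
    (h2 : ∀ a j, central a j ∈ S) (h3 : ∀ i, der i ∈ S) : S = ⊤ := by
  refine eq_top_iff.2 fun u _ => ?_
  have hu : u = ⟨u.loop, 0, 0⟩ + ⟨0, u.cent, 0⟩ + degElt u.deg := by
    ext1 <;> simp [degElt]
  rw [hu]
  refine S.add_mem (S.add_mem ?_ ?_) ?_
  · let f : Loop 𝔤 n →ₗ[ℂ] ToroidalAlgebra n 𝔤 :=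
      { toFun := fun k => ⟨k, 0, 0⟩
        map_add' := fun c c' => by ext1 <;> simp
        map_smul' := fun r c => by ext1 <;> simp }
    change f u.loop ∈ S
    induction u.loop using TensorProduct.induction_on with
    | zero => simp
    | add u v hu hv => rw [map_add]; exact S.add_mem hu hv
    | tmul p x =>
      let g : Laurent n →ₗ[ℂ] ToroidalAlgebra n 𝔤 :=
        f.comp ((TensorProduct.mk ℂ (Laurent n) 𝔤).flip x)
      have hg : g p ∈ S := by
        have : S.mkQ.comp g = 0 := laurent_hom_ext fun a =>
          (Submodule.Quotient.mk_eq_zero S).2 (h1 x a)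
        exact (Submodule.Quotient.mk_eq_zero S).1 (LinearMap.congr_fun this p)
      exact hg
  · let f : KA n →ₗ[ℂ] ToroidalAlgebra n 𝔤 :=
      { toFun := fun k => ⟨0, k, 0⟩
        map_add' := fun c c' => by ext1 <;> simp
        map_smul' := fun r c => by ext1 <;> simp }
    change f u.cent ∈ S
    have : S.mkQ.comp (f.comp (exactForms n).mkQ) = 0 := by
      refine LinearMap.pi_ext' fun j => laurent_hom_ext fun a => ?_
      exact (Submodule.Quotient.mk_eq_zero S).2 (h2 a j)
    obtain ⟨w, hw⟩ := (exactForms n).mkQ_surjective u.cent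
    rw [← hw]
    exact (Submodule.Quotient.mk_eq_zero S).1 (LinearMap.congr_fun this w)
  · rw [degElt_eq_sum]
    exact S.sum_mem fun i _ => S.smul_mem _ (h3 i)

lemma elt_injective (a : Fin n → ℤ) :
    Function.Injective fun x : 𝔤 => (elt x a : ToroidalAlgebra n 𝔤) := by
  intro x y h
  have h1 : (mono a ⊗ₜ[ℂ] x : Loop 𝔤 n) = mono a ⊗ₜ[ℂ] y := congrArg loop h
  have h2 := congrArg (TensorProduct.lid ℂ 𝔤)
    (congrArg (((AddMonoidAlgebra.basis (Fin n → ℤ) ℂ).coord a).rTensor 𝔤) h1)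
  simpa only [LinearMap.rTensor_tmul, mono_eq_basis, Module.Basis.coord_apply,
    Module.Basis.repr_self, Finsupp.single_eq_same, TensorProduct.lid_tmul, one_smul] using h2

variable (n) in
/-- The decomposition `𝔥̃ₙ = 𝔥 ⊕ D`. -/
def cartanEquiv (𝔥 : LieSubalgebra ℂ 𝔤) : (𝔥 × (Fin n → ℂ)) ≃ₗ[ℂ] cartan n 𝔥 :=
  let f : (𝔥 × (Fin n → ℂ)) →ₗ[ℂ] ToroidalAlgebra n 𝔤 :=
    { toFun := fun p => elt (p.1 : 𝔤) 0 + degElt p.2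
      map_add' := fun p q => by ext1 <;> simp [elt, degElt, loopElt, TensorProduct.tmul_add]
      map_smul' := fun r p => by ext1 <;> simp [elt, degElt, loopElt] }
  LinearEquiv.ofBijective
    (f.codRestrict (cartan n 𝔥).toSubmodule
      fun p => ⟨⟨p.1, p.1.2, by simp [f, elt, degElt]⟩, by simp [f, elt, degElt]⟩)
    ⟨by
      rintro ⟨h, c⟩ ⟨h', c'⟩ hp
      have h1 : elt (h : 𝔤) 0 + degElt c = (elt (h' : 𝔤) 0 + degElt c' : ToroidalAlgebra n 𝔤) :=
        congrArg Subtype.val hp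
      have h2 : c = c' := by simpa [elt, degElt] using congrArg deg h1
      rw [h2] at h1
      exact Prod.ext (Subtype.ext (elt_injective 0 (add_right_cancel h1))) h2,
    fun ⟨u, ⟨h, hh, hu⟩, hu'⟩ => ⟨(⟨h, hh⟩, u.deg), Subtype.ext (by
      ext1 <;> simp [f, elt, degElt, hu, hu'])⟩⟩

lemma cartanEquiv_apply (𝔥 : LieSubalgebra ℂ 𝔤) (p : 𝔥 × (Fin n → ℂ)) :
    (cartanEquiv n 𝔥 p : ToroidalAlgebra n 𝔤) = elt (p.1 : 𝔤) 0 + degElt p.2 := rfl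

instance (𝔥 : LieSubalgebra ℂ 𝔤) [IsLieAbelian 𝔥] : IsLieAbelian (cartan n 𝔥) where
  trivial x y := by
    obtain ⟨⟨h, c⟩, rfl⟩ := (cartanEquiv n 𝔥).surjective x
    obtain ⟨⟨h', c'⟩, rfl⟩ := (cartanEquiv n 𝔥).surjective y
    refine Subtype.ext ?_
    have hh : ⁅(h : 𝔤), (h' : 𝔤)⁆ = 0 := by
      rw [← LieSubalgebra.coe_bracket, trivial_lie_zero, ZeroMemClass.coe_zero]
    have hd : ⁅(degElt c : ToroidalAlgebra n 𝔤), (degElt c' : ToroidalAlgebra n 𝔤)⁆ = 0 := by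
      ext1 <;> simp [degElt]
    rw [LieSubalgebra.coe_bracket, cartanEquiv_apply, cartanEquiv_apply, ZeroMemClass.coe_zero,
      add_lie, lie_add, lie_add, elt_lie_elt_of_zero_left, degElt_lie_elt, hd,
      ← lie_skew (elt _ _) (degElt _), degElt_lie_elt]
    simp [hh, elt_zero_vec, pairing_zero_right]

/-- The weight on `𝔥̃ₙ` of a root vector of degree `a`. -/
def weight {𝔥 : LieSubalgebra ℂ 𝔤} (α : Module.Dual ℂ 𝔥) (a : Fin n → ℤ) :
    Module.Dual ℂ (cartan n 𝔥) :=
  (α.coprod (Fintype.linearCombination ℂ fun i => (a i : ℂ))).comp (cartanEquiv n 𝔥).symm.toLinearMap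

lemma weight_cartanEquiv {𝔥 : LieSubalgebra ℂ 𝔤} (α : Module.Dual ℂ 𝔥) (a : Fin n → ℤ)
    (p : 𝔥 × (Fin n → ℂ)) : weight α a (cartanEquiv n 𝔥 p) = α p.1 + pairing p.2 a := by
  simp [weight, Fintype.linearCombination_apply, pairing]

lemma cartan_lie_elt {𝔥 : LieSubalgebra ℂ 𝔤} {α : Module.Dual ℂ 𝔥} {x : 𝔤}
    (hx : ∀ h : 𝔥, ⁅(h : 𝔤), x⁆ = α h • x) (a : Fin n → ℤ) (y : cartan n 𝔥) :
    ⁅(y : ToroidalAlgebra n 𝔤), elt x a⁆ = weight α a y • elt x a := by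
  obtain ⟨p, rfl⟩ := (cartanEquiv n 𝔥).surjective y
  rw [weight_cartanEquiv, cartanEquiv_apply, add_lie, elt_lie_elt_of_zero_left, hx, elt_smul,
    degElt_lie_elt, add_smul]

end ToroidalAlgebra

end

noncomputable section

/-! ### The decomposition of `U(𝔥̃ₙ)` and the shift-invariant elements. -/

namespace ToroidalAlgebra

open UniversalEnvelopingAlgebra

variable {n : ℕ} {𝔤 : Type*} [LieRing 𝔤] [LieAlgebra ℂ 𝔤] {𝔥 : LieSubalgebra ℂ 𝔤} [IsLieAbelian 𝔥]

attribute [local instance] LieRing.ofAssociativeRing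

variable (n 𝔥) in
/-- The embedding `U(𝔥) → U(𝔥̃ₙ)`. -/
def inclU : UniversalEnvelopingAlgebra ℂ 𝔥 →ₐ[ℂ] UniversalEnvelopingAlgebra ℂ (cartan n 𝔥) :=
  liftLinear ((ι ℂ : cartan n 𝔥 →ₗ⁅ℂ⁆ _).toLinearMap ∘ₗ (cartanEquiv n 𝔥).toLinearMap ∘ₗ
    LinearMap.inl ℂ 𝔥 (Fin n → ℂ)) fun _ _ => mul_comm_of_isLieAbelian _ _

@[simp] lemma inclU_ι (h : 𝔥) : inclU n 𝔥 (ι ℂ h) = ι ℂ (cartanEquiv n 𝔥 (h, 0)) := by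
  rw [inclU, liftLinear_ι]; rfl

variable (n 𝔥) in
/-- The embedding `ℂ[d₁, …, dₙ] → U(𝔥̃ₙ)`. -/
def inclPD : PD n →ₐ[ℂ] UniversalEnvelopingAlgebra ℂ (cartan n 𝔥) :=
  letI := commRing (𝔟 := cartan n 𝔥)
  MvPolynomial.aeval fun i => ι ℂ (cartanEquiv n 𝔥 (0, Pi.single i 1))

@[simp] lemma inclPD_X (i : Fin n) :
    inclPD n 𝔥 (MvPolynomial.X i) = ι ℂ (cartanEquiv n 𝔥 (0, Pi.single i 1)) :=
  letI := commRing (𝔟 := cartan n 𝔥)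
  MvPolynomial.aeval_X _ _

lemma inclPD_degPoly (c : Fin n → ℂ) :
    inclPD n 𝔥 (degPoly n c) = ι ℂ (cartanEquiv n 𝔥 (0, c)) := by
  have : (inclPD n 𝔥).toLinearMap ∘ₗ degPoly n = (ι ℂ : cartan n 𝔥 →ₗ⁅ℂ⁆ _).toLinearMap ∘ₗ
      (cartanEquiv n 𝔥).toLinearMap ∘ₗ LinearMap.inr ℂ 𝔥 (Fin n → ℂ) := by
    refine LinearMap.pi_ext' fun i => LinearMap.ext_ring ?_
    simp only [LinearMap.comp_apply, LinearMap.single_apply, AlgHom.toLinearMap_apply]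
    have : degPoly n (Pi.single i 1) = MvPolynomial.X i := by
      simp [degPoly, Pi.single_apply]
    rw [this, inclPD_X]
    rfl
  exact LinearMap.congr_fun this c

variable (n 𝔥) in
/-- The multiplication map `U(𝔥) ⊗ ℂ[d₁, …, dₙ] → U(𝔥̃ₙ)`. -/
def tensorHom :
    UniversalEnvelopingAlgebra ℂ 𝔥 ⊗[ℂ] PD n →ₐ[ℂ] UniversalEnvelopingAlgebra ℂ (cartan n 𝔥) :=
  Algebra.TensorProduct.lift (inclU n 𝔥) (inclPD n 𝔥) fun _ _ => mul_comm_of_isLieAbelian _ _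

lemma tensorHom_tmul (v : UniversalEnvelopingAlgebra ℂ 𝔥) (p : PD n) :
    tensorHom n 𝔥 (v ⊗ₜ p) = inclU n 𝔥 v * inclPD n 𝔥 p :=
  rfl

variable (n 𝔥) in
/-- The map `U(𝔥̃ₙ) → U(𝔥) ⊗ ℂ[d₁, …, dₙ]` with `h + c ↦ h ⊗ 1 + 1 ⊗ c`. -/
def tensorInv :
    UniversalEnvelopingAlgebra ℂ (cartan n 𝔥) →ₐ[ℂ] UniversalEnvelopingAlgebra ℂ 𝔥 ⊗[ℂ] PD n :=
  liftLinear (LinearMap.coprod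
      ((TensorProduct.mk ℂ _ _).flip 1 ∘ₗ (ι ℂ : 𝔥 →ₗ⁅ℂ⁆ _).toLinearMap)
      (TensorProduct.mk ℂ _ _ 1 ∘ₗ degPoly n) ∘ₗ (cartanEquiv n 𝔥).symm.toLinearMap)
      fun _ _ => letI := commRing (𝔟 := 𝔥); mul_comm _ _

lemma tensorInv_ι (p : 𝔥 × (Fin n → ℂ)) :
    tensorInv n 𝔥 (ι ℂ (cartanEquiv n 𝔥 p)) = ι ℂ p.1 ⊗ₜ 1 + 1 ⊗ₜ degPoly n p.2 := by
  rw [tensorInv, liftLinear_ι, LinearMap.comp_apply, LinearEquiv.coe_coe,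
    LinearEquiv.symm_apply_apply]
  rfl

variable (n 𝔥) in
/-- `U(𝔥̃ₙ) = U(𝔥) ⊗ ℂ[d₁, …, dₙ]`. -/
def tensorEquiv :
    UniversalEnvelopingAlgebra ℂ 𝔥 ⊗[ℂ] PD n ≃ₐ[ℂ] UniversalEnvelopingAlgebra ℂ (cartan n 𝔥) :=
  AlgEquiv.ofAlgHom (tensorHom n 𝔥) (tensorInv n 𝔥)
    (algHom_ext_ι fun y => by
      obtain ⟨⟨h, c⟩, rfl⟩ := (cartanEquiv n 𝔥).surjective y
      rw [AlgHom.comp_apply, AlgHom.id_apply, tensorInv_ι, map_add, tensorHom_tmul,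
        tensorHom_tmul, map_one, map_one, mul_one, one_mul, inclPD_degPoly, inclU_ι,
        ← map_add, ← map_add, Prod.mk_add_mk, add_zero, zero_add])
    (Algebra.TensorProduct.ext (algHom_ext_ι fun h => by
      rw [AlgHom.comp_apply, Algebra.TensorProduct.includeLeft_apply, AlgHom.comp_apply,
        tensorHom_tmul, map_one, mul_one, inclU_ι, tensorInv_ι]
      simp) (MvPolynomial.algHom_ext fun i => by
      rw [AlgHom.comp_apply, AlgHom.comp_apply]
      change tensorInv n 𝔥 (tensorHom n 𝔥 (1 ⊗ₜ MvPolynomial.X i)) = 1 ⊗ₜ MvPolynomial.X i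
      rw [tensorHom_tmul, map_one, one_mul, inclPD_X, tensorInv_ι]
      simp [degPoly, Pi.single_apply]))

@[simp] lemma tensorEquiv_tmul (v : UniversalEnvelopingAlgebra ℂ 𝔥) (p : PD n) :
    tensorEquiv n 𝔥 (v ⊗ₜ p) = inclU n 𝔥 v * inclPD n 𝔥 p :=
  rfl

/-- Root vectors of degree `a` act on `ℂ[d₁, …, dₙ]` through the shift by `a`. -/
lemma weightShift_weight_inclPD (α : Module.Dual ℂ 𝔥) (a : Fin n → ℤ) (p : PD n) :
    weightShift (weight α a) (inclPD n 𝔥 p) = inclPD n 𝔥 (shift a p) := by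
  have : (weightShift (weight α a)).comp (inclPD n 𝔥) = (inclPD n 𝔥).comp (shift a) := by
    refine MvPolynomial.algHom_ext fun i => ?_
    simp only [AlgHom.comp_apply, inclPD_X, weightShift_ι, weight_cartanEquiv, shift_X, map_sub,
      map_zero, zero_add, pairing_single]
    rw [← MvPolynomial.algebraMap_eq, AlgHom.commutes]
  exact AlgHom.congr_fun this p

lemma weightShift_weight_inclU (α : Module.Dual ℂ 𝔥) (a : Fin n → ℤ)
    (v : UniversalEnvelopingAlgebra ℂ 𝔥) :
    weightShift (weight α a) (inclU n 𝔥 v) = inclU n 𝔥 (weightShift α v) := by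
  have : (weightShift (weight α a)).comp (inclU n 𝔥) = (inclU n 𝔥).comp (weightShift α) := by
    refine algHom_ext_ι fun h => ?_
    rw [AlgHom.comp_apply, AlgHom.comp_apply, inclU_ι, weightShift_ι, weight_cartanEquiv,
      weightShift_ι, map_sub, AlgHom.commutes, inclU_ι]
    simp [pairing]
  exact AlgHom.congr_fun this v

lemma shift_zero (p : PD n) : shift 0 p = p := by
  have : shift (0 : Fin n → ℤ) = AlgHom.id ℂ (PD n) := MvPolynomial.algHom_ext fun i => by
    simp [shift_X]
  rw [this, AlgHom.id_apply]

/-- Evaluated at the origin, invariance says that `p` takes the value `p(0)` at every integer point,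
and these points determine a polynomial. -/
lemma shift_invariant {p : PD n} (hp : ∀ a, shift a p = p) : ∃ c, p = MvPolynomial.C c := by
  refine ⟨MvPolynomial.eval 0 p, ?_⟩
  refine MvPolynomial.funext_set (fun _ => Set.range (fun k : ℤ => (k : ℂ)))
    (fun _ => Set.infinite_range_of_injective Int.cast_injective) fun x hx => ?_
  choose a ha using fun i => hx i (Set.mem_univ i)
  have h1 := congrArg (MvPolynomial.eval 0) (hp (-a))
  have h2 : ∀ q : PD n, MvPolynomial.eval 0 (shift (-a) q) = MvPolynomial.eval x q := by
    intro q
    have : (MvPolynomial.aeval (0 : Fin n → ℂ)).comp (shift (-a)) = MvPolynomial.aeval x := by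
      refine MvPolynomial.algHom_ext fun i => ?_
      rw [AlgHom.comp_apply, shift_X]
      simp [← ha i]
    exact AlgHom.congr_fun this q
  rw [h2] at h1
  rw [h1, MvPolynomial.eval_C]

/-- The elements of `U(𝔥̃ₙ)` invariant under the shifts of the `dᵢ` are those of `U(𝔥)`. -/
lemma exists_inclU_eq {u : UniversalEnvelopingAlgebra ℂ (cartan n 𝔥)}
    (hu : ∀ a, weightShift (weight (0 : Module.Dual ℂ 𝔥) a) u = u) : ∃ v, u = inclU n 𝔥 v := by
  classical
  obtain ⟨t, rfl⟩ := (tensorEquiv n 𝔥).surjective u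
  have key : ∀ a, (shift a).toLinearMap.lTensor _ t = t := by
    intro a
    refine (tensorEquiv n 𝔥).injective ((hu a).symm.trans ?_).symm
    have : (weightShift (weight (0 : Module.Dual ℂ 𝔥) a)).toLinearMap ∘ₗ
        (tensorEquiv n 𝔥).toLinearMap
        = (tensorEquiv n 𝔥).toLinearMap ∘ₗ (shift a).toLinearMap.lTensor _ := by
      refine TensorProduct.ext' fun v p => ?_
      change weightShift _ (tensorEquiv n 𝔥 (v ⊗ₜ p)) = tensorEquiv n 𝔥 (v ⊗ₜ shift a p)
      rw [tensorEquiv_tmul, tensorEquiv_tmul, map_mul, weightShift_weight_inclU,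
        weightShift_weight_inclPD, weightShift_zero]
    exact LinearMap.congr_fun this t
  -- Expanded along a basis of `U(𝔥)`, the coordinates of `t` are polynomials in the `dᵢ`; each one
  -- is shift-invariant, hence constant.
  let b := Module.Basis.ofVectorSpace ℂ (UniversalEnvelopingAlgebra ℂ 𝔥)
  let φ := TensorProduct.equivFinsuppOfBasisLeft (N := PD n) b
  have hφ : ∀ a i, shift a (φ t i) = φ t i := by
    intro a i
    conv_rhs => rw [← key a]
    simp only [φ, TensorProduct.equivFinsuppOfBasisLeft_apply]
    have : (shift a).toLinearMap ∘ₗ (TensorProduct.lid ℂ (PD n)).toLinearMap ∘ₗ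
        (b.coord i).rTensor (PD n) = (TensorProduct.lid ℂ (PD n)).toLinearMap ∘ₗ
        (b.coord i).rTensor (PD n) ∘ₗ (shift a).toLinearMap.lTensor _ :=
      TensorProduct.ext' fun v p => by simp
    exact LinearMap.congr_fun this t
  choose c hc using fun i => shift_invariant fun a => hφ a i
  refine ⟨(φ t).sum fun i _ => c i • b i, ?_⟩
  have ht : t = ((φ t).sum fun i _ => c i • b i) ⊗ₜ 1 := by
    conv_lhs => rw [← φ.symm_apply_apply t]
    rw [TensorProduct.equivFinsuppOfBasisLeft_symm_apply, Finsupp.sum, Finsupp.sum,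
      TensorProduct.sum_tmul]
    refine Finset.sum_congr rfl fun i _ => ?_
    rw [hc i, TensorProduct.smul_tmul, MvPolynomial.smul_eq_C_mul, mul_one]
  conv_lhs => rw [ht]
  rw [tensorEquiv_tmul, map_one, mul_one]

end ToroidalAlgebra

/-! ### Freeness of the modules `M̃(λ, M)`. -/

namespace TildeModule

open UniversalEnvelopingAlgebra ToroidalAlgebra

variable {n : ℕ} {𝔤 : Type*} [LieRing 𝔤] [LieAlgebra ℂ 𝔤] {𝔥 : LieSubalgebra ℂ 𝔤} [IsLieAbelian 𝔥]

lemma hom_ext {lam : Fin n → ℂˣ} {M V : Type*} [AddCommGroup M] [Module ℂ M] [AddCommGroup V]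
    [Module ℂ V] {f g : TildeModule lam M →ₗ[ℂ] V}
    (h : ∀ v p, f (mk lam M v p) = g (mk lam M v p)) : f = g :=
  TensorProduct.ext' h

lemma degElt_lie_mk (lam : Fin n → ℂˣ) (M : Type*) [AddCommGroup M] [Module ℂ M]
    [LieRingModule 𝔤 M] [LieModule ℂ 𝔤 M] (c : Fin n → ℂ) (v : M) (p : PD n) :
    ⁅(degElt c : ToroidalAlgebra n 𝔤), mk lam M v p⁆ = mk lam M v (degPoly n c * p) := by
  change act lam M _ (v ⊗ₜ[ℂ] p) = v ⊗ₜ[ℂ] (degPoly n c * p)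
  simp [act_apply, degElt]

/-- Elements of degree zero carry the scalar `λ^0 = 1` and the trivial shift, so `𝔥` acts on the
first factor only and `D` on the second only; `tensorEquiv` then applies. -/
lemma isFreeRankOne (lam : Fin n → ℂˣ) (M : Type*) [AddCommGroup M] [Module ℂ M]
    [LieRingModule 𝔤 M] [LieModule ℂ 𝔤 M] (h : IsFreeRankOne 𝔥 M) :
    IsFreeRankOne (cartan n 𝔥) (TildeModule lam M) := by
  obtain ⟨e, he⟩ := h
  have he' : ∀ (x : 𝔥) (v : M), e ⁅(x : 𝔤), v⁆ = ι ℂ x * e v := fun x v => by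
    rw [← he, lift_ι_apply]; rfl
  let E : TildeModule lam M ≃ₗ[ℂ] UniversalEnvelopingAlgebra ℂ (cartan n 𝔥) :=
    (TensorProduct.congr e (LinearEquiv.refl ℂ (PD n))).trans (tensorEquiv n 𝔥).toLinearEquiv
  have hE : ∀ v p, E (mk lam M v p) = inclU n 𝔥 (e v) * inclPD n 𝔥 p := fun v p => rfl
  refine isFreeRankOne_of_equiv E fun x w => ?_
  obtain ⟨⟨h, c⟩, rfl⟩ := (cartanEquiv n 𝔥).surjective x
  have hx : cartanEquiv n 𝔥 (h, c) = cartanEquiv n 𝔥 (h, 0) + cartanEquiv n 𝔥 (0, c) := by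
    rw [← map_add, Prod.mk_add_mk, add_zero, zero_add]
  have : E.toLinearMap ∘ₗ LieModule.toEnd ℂ (ToroidalAlgebra n 𝔤) (TildeModule lam M)
      (cartanEquiv n 𝔥 (h, c)) = LinearMap.mulLeft ℂ (ι ℂ (cartanEquiv n 𝔥 (h, c))) ∘ₗ
        E.toLinearMap := by
    refine hom_ext fun v p => ?_
    change E ⁅(cartanEquiv n 𝔥 (h, c) : ToroidalAlgebra n 𝔤), mk lam M v p⁆
      = ι ℂ (cartanEquiv n 𝔥 (h, c)) * E (mk lam M v p)
    rw [cartanEquiv_apply, add_lie, elt_lie_mk, degElt_lie_mk, map_add, map_smul, hE, hE, hE, he',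
      map_mul, map_mul, inclU_ι, inclPD_degPoly, hx, map_add, add_mul, ← mul_assoc, ← mul_assoc,
      mul_comm_of_isLieAbelian (inclU n 𝔥 (e v)) (ι ℂ _), mul_assoc, mul_assoc]
    simp [monoVal, shift_zero, mul_assoc]
  exact LinearMap.congr_fun this w

end TildeModule

end

noncomputable section

/-! ### Coordinates on `U(𝔥̃ₙ)` adapted to one root. -/

section

open MvPolynomial

/-- Translations of a polynomial ring along an additive map form a translation action. -/
lemma isTranslationAction_aeval {G κ : Type*} [AddCommGroup G] (δ : G →+ (κ → ℂ)) :
    IsTranslationAction fun a : G =>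
      ((aeval fun j => X j - C (δ a j) : MvPolynomial κ ℂ →ₐ[ℂ] MvPolynomial κ ℂ) :
        MvPolynomial κ ℂ →+* MvPolynomial κ ℂ) where
  zero := by
    refine ringHom_ext (fun r => ?_) fun j => ?_
    · simp [← algebraMap_eq]
    · simp
  add a b x := by
    have : (aeval fun j => X j - C (δ (a + b) j) : MvPolynomial κ ℂ →ₐ[ℂ] MvPolynomial κ ℂ)
        = (aeval fun j => X j - C (δ a j)).comp (aeval fun j => X j - C (δ b j)) := by
      refine algHom_ext fun j => ?_
      simp only [AlgHom.comp_apply, aeval_X, map_sub, map_add, Pi.add_apply]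
      rw [← algebraMap_eq, AlgHom.commutes]
      ring
    exact AlgHom.congr_fun this x
  unit a x hx := by
    obtain ⟨c, -, rfl⟩ := (isUnit_iff_eq_C_of_isReduced).1 hx
    exact AlgHom.commutes (aeval fun j => X j - C (δ a j)) c
  two a p hp := by
    refine funext fun x => ?_
    -- The polynomial `q p` is the restriction of `p` to the line through `x` with direction `-δ a`.
    -- Invariance under `2 δ a` makes it periodic with period `2`, hence constant; its values at `0`
    -- and `1` are the two sides.
    let q : MvPolynomial κ ℂ →ₐ[ℂ] Polynomial ℂ :=
      aeval fun j => Polynomial.C (x j) - Polynomial.C (δ a j) * Polynomial.X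
    have h2 : Polynomial.taylor 2 (q p) = q p := by
      have : ((Polynomial.taylorAlgHom (2 : ℂ)).restrictScalars ℂ).comp q
          = q.comp (aeval fun j => X j - C (δ (a + a) j)) := by
        refine algHom_ext fun j => ?_
        simp only [AlgHom.comp_apply, aeval_X, q, map_sub, map_add, Pi.add_apply]
        rw [← algebraMap_eq, AlgHom.commutes, map_mul]
        simp
        linear_combination (-Polynomial.C (δ a j)) *
          (map_ofNat Polynomial.C 2 : Polynomial.C (2 : ℂ) = 2)
      conv_rhs => rw [← hp]
      exact AlgHom.congr_fun this p
    obtain ⟨c, hc⟩ := Polynomial.eq_C_of_taylor_eq two_ne_zero h2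
    have h0 : ∀ t : ℂ, (q p).eval t = eval (fun j => x j - δ a j * t) p := by
      intro t
      have : (Polynomial.aeval t).comp q = aeval fun j => x j - δ a j * t := by
        refine algHom_ext fun j => ?_
        simp [q]
      exact AlgHom.congr_fun this p
    have h1 : eval x (aeval (fun j => X j - C (δ a j)) p) = eval (fun j => x j - δ a j * 1) p := by
      have : (aeval x).comp (aeval (R := ℂ) fun j => (X j - C (δ a j) : MvPolynomial κ ℂ))
          = aeval fun j => x j - δ a j * 1 := by
        refine algHom_ext fun j => ?_
        simp
      exact AlgHom.congr_fun this p
    change eval x (aeval (fun j => X j - C (δ a j)) p) = _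
    rw [h1, ← h0, hc, Polynomial.eval_C]
    have := h0 0
    rw [hc, Polynomial.eval_C] at this
    simpa using this

end

namespace ToroidalAlgebra

open UniversalEnvelopingAlgebra

variable {n : ℕ} {𝔤 : Type*} [LieRing 𝔤] [LieAlgebra ℂ 𝔤] {𝔥 : LieSubalgebra ℂ 𝔤} [IsLieAbelian 𝔥]

attribute [local instance] LieRing.ofAssociativeRing

/-- `U(𝔥̃ₙ)` as a polynomial algebra in one variable `h` over an algebra on which the root `α` with
`α(h) = 2` vanishes. -/
lemma exists_adapted_polynomial [FiniteDimensional ℂ 𝔥] {α : Module.Dual ℂ 𝔥} {h : 𝔥}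
    (hα : α h = 2) :
    ∃ (m : ℕ) (Φ : UniversalEnvelopingAlgebra ℂ (cartan n 𝔥) ≃ₐ[ℂ]
        Polynomial (MvPolynomial (Fin m) ℂ))
      (τ : (Fin n → ℤ) → MvPolynomial (Fin m) ℂ →+* MvPolynomial (Fin m) ℂ),
      IsTranslationAction τ ∧ Φ (ι ℂ (cartanEquiv n 𝔥 (h, 0))) = Polynomial.X ∧
      ∀ (k : ℤ) (a : Fin n → ℤ) (u : UniversalEnvelopingAlgebra ℂ (cartan n 𝔥)),
        Φ (weightShift (weight (k • α) a) u)
          = Polynomial.taylor ((-2 * k : ℤ) : MvPolynomial (Fin m) ℂ) ((Φ u).map (τ a)) := by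
  have : FiniteDimensional ℂ (cartan n 𝔥) := Module.Finite.equiv (cartanEquiv n 𝔥)
  let y := cartanEquiv n 𝔥 (h, 0)
  -- With degree `0` in the weight, this hyperplane contains all of `D`; the element `y` spans a
  -- complement and is not moved by the degree shifts.
  let K := LinearMap.ker (weight α (0 : Fin n → ℤ))
  have hy : weight α (0 : Fin n → ℤ) y = 2 := by
    simp [y, weight_cartanEquiv, hα, pairing]
  let v := Module.Basis.mkFinCons y (Module.finBasis ℂ K)
    (fun c x hx hc => by
      have := congrArg (weight α (0 : Fin n → ℤ)) hc
      rw [map_add, map_smul, hy, LinearMap.mem_ker.1 hx] at this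
      simpa using this)
    (fun z => ⟨-(weight α (0 : Fin n → ℤ) z) / 2, by
      rw [LinearMap.mem_ker, map_add, map_smul, hy, smul_eq_mul]
      ring⟩)
  have hv0 : v 0 = y := by simp [v]
  have hvs : ∀ j, v (Fin.succ j) ∈ K := fun j => by simp [v]
  let δ : (Fin n → ℤ) →+ (Fin (Module.finrank ℂ K) → ℂ) :=
    { toFun := fun a j => weight (0 : Module.Dual ℂ 𝔥) a (v j.succ)
      map_zero' := funext fun j => by
        obtain ⟨p, hp⟩ := (cartanEquiv n 𝔥).surjective (v j.succ)
        simp [← hp, weight_cartanEquiv, pairing]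
      map_add' := fun a b => funext fun j => by
        obtain ⟨p, hp⟩ := (cartanEquiv n 𝔥).surjective (v j.succ)
        simp [← hp, weight_cartanEquiv, pairing_add] }
  let Φ := (equivMvPolynomial v).trans (MvPolynomial.finSuccEquiv ℂ _)
  have hΦ0 : Φ (ι ℂ y) = Polynomial.X := by
    rw [← hv0]
    change MvPolynomial.finSuccEquiv ℂ _ (equivMvPolynomial v (ι ℂ (v 0))) = _
    rw [equivMvPolynomial_ι, MvPolynomial.finSuccEquiv_X_zero]
  have hΦs : ∀ j : Fin _, Φ (ι ℂ (v j.succ)) = Polynomial.C (MvPolynomial.X j) := fun j => by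
    change MvPolynomial.finSuccEquiv ℂ _ (equivMvPolynomial v (ι ℂ (v j.succ))) = _
    rw [equivMvPolynomial_ι, MvPolynomial.finSuccEquiv_X_succ]
  refine ⟨_, Φ, _, isTranslationAction_aeval δ, hΦ0, fun k a u => ?_⟩
  let f1 := Φ.toAlgHom.comp (weightShift (weight (k • α) a))
  let f2 := ((Polynomial.taylorAlgHom
    ((-2 * k : ℤ) : MvPolynomial (Fin (Module.finrank ℂ K)) ℂ)).restrictScalars ℂ).comp
      ((Polynomial.mapAlgHom (MvPolynomial.aeval (R := ℂ) fun j =>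
        (MvPolynomial.X j - MvPolynomial.C (δ a j) : MvPolynomial _ ℂ))).comp Φ.toAlgHom)
  suffices f1 = f2 from AlgHom.congr_fun this u
  refine algHom_ext_ι fun x => ?_
  have hlin : f1.toLinearMap ∘ₗ (ι ℂ : cartan n 𝔥 →ₗ⁅ℂ⁆ _).toLinearMap
      = f2.toLinearMap ∘ₗ (ι ℂ : cartan n 𝔥 →ₗ⁅ℂ⁆ _).toLinearMap := by
    refine v.ext fun j => ?_
    change Φ (weightShift _ (ι ℂ (v j)))
      = Polynomial.taylor _ ((Φ (ι ℂ (v j))).map _)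
    rw [weightShift_ι, map_sub, AlgEquiv.commutes]
    refine Fin.cases ?_ (fun j => ?_) j
    · rw [hv0, hΦ0]
      have : weight (k • α) a y = 2 * k := by
        simp [y, weight_cartanEquiv, hα, pairing, mul_comm]
      rw [this]
      simp [map_ofNat, sub_eq_add_neg]
    · rw [hΦs]
      have : weight (k • α) a (v j.succ) = δ a j := by
        obtain ⟨p, hp⟩ := (cartanEquiv n 𝔥).surjective (v j.succ)
        have h0 : α p.1 = 0 := by
          have := LinearMap.mem_ker.1 (hvs j)
          rw [← hp, weight_cartanEquiv] at this
          simpa [pairing] using this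
        simp [δ, ← hp, weight_cartanEquiv, h0]
      rw [this]
      simp
  exact LinearMap.congr_fun hlin x

end ToroidalAlgebra

end

/-! ### The loop subalgebra of a simple root acting on the generator. -/

noncomputable section

lemma exists_monoVal {n : ℕ} (r : (Fin n → ℤ) → ℂˣ) (hr : ∀ a b, r (a + b) = r a * r b) :
    ∃ lam : Fin n → ℂˣ, ∀ a, r a = monoVal lam a := by
  let f : (Fin n → ℤ) →+ Additive ℂˣ :=
    AddMonoidHom.mk' (fun a => Additive.ofMul (r a)) fun a b => by rw [hr]; rfl
  refine ⟨fun i => r (Pi.single i 1), fun a => ?_⟩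
  have ha : a = ∑ i, a i • Pi.single i (1 : ℤ) := by
    ext j
    simp [Finset.sum_apply, Pi.single_apply]
  have h1 := congrArg f ha
  rw [map_sum] at h1
  simp only [map_zsmul] at h1
  have h2 := congrArg Additive.toMul h1
  rw [toMul_sum] at h2
  exact h2

namespace ToroidalAlgebra

open UniversalEnvelopingAlgebra

variable {n : ℕ} {𝔤 : Type*} [LieRing 𝔤] [LieAlgebra ℂ 𝔤] {𝔥 : LieSubalgebra ℂ 𝔤} [IsLieAbelian 𝔥]
  {N : Type*} [AddCommGroup N] [Module ℂ N] [LieRingModule (ToroidalAlgebra n 𝔤) N]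
  [LieModule ℂ (ToroidalAlgebra n 𝔤) N]

attribute [local instance] LieRing.ofAssociativeRing

/-- Invariance gives `0 = ([h, h], x) = (h, [h, x]) = c (h, x)`. This removes the central term from
`[h(a), x(b)]`. -/
lemma killingForm_eq_zero_of_lie {h x : 𝔤} {c : ℂ} (hc : c ≠ 0) (hx : ⁅h, x⁆ = c • x) :
    killingForm ℂ 𝔤 h x = 0 := by
  have h1 := LieModule.traceForm_apply_lie_apply ℂ 𝔤 𝔤 h h x
  rw [lie_self, hx, map_zero, LinearMap.zero_apply, map_smul, smul_eq_mul, eq_comm,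
    mul_eq_zero] at h1
  exact h1.resolve_left hc

variable (e : N ≃ₗ[ℂ] UniversalEnvelopingAlgebra ℂ (cartan n 𝔥))
  (he : ∀ u v, e (act (cartan n 𝔥) N u v) = u * e v)
include he

omit [IsLieAbelian 𝔥] in
lemma act_symm_one (u : UniversalEnvelopingAlgebra ℂ (cartan n 𝔥)) :
    act (cartan n 𝔥) N u (e.symm 1) = e.symm u := by
  apply e.injective
  rw [he, e.apply_symm_apply, e.apply_symm_apply, mul_one]

/-- The action of a weight vector on a free module of rank one is determined by its value on the
generator. -/
lemma map_lie_of_weight {x : ToroidalAlgebra n 𝔤} {χ : Module.Dual ℂ (cartan n 𝔥)}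
    (hx : ∀ y : cartan n 𝔥, ⁅(y : ToroidalAlgebra n 𝔤), x⁆ = χ y • x) (v : N) :
    e ⁅x, v⁆ = weightShift χ (e v) * e ⁅x, e.symm 1⁆ := by
  rw [← he, ← lie_act hx, act_symm_one e he, e.symm_apply_apply]

lemma map_lie_lie_of_weight {x y : ToroidalAlgebra n 𝔤} {χ ψ : Module.Dual ℂ (cartan n 𝔥)}
    (hx : ∀ z : cartan n 𝔥, ⁅(z : ToroidalAlgebra n 𝔤), x⁆ = χ z • x)
    (hy : ∀ z : cartan n 𝔥, ⁅(z : ToroidalAlgebra n 𝔤), y⁆ = ψ z • y) :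
    e ⁅⁅x, y⁆, e.symm 1⁆ = weightShift χ (e ⁅y, e.symm 1⁆) * e ⁅x, e.symm 1⁆
      - weightShift ψ (e ⁅x, e.symm 1⁆) * e ⁅y, e.symm 1⁆ := by
  rw [lie_lie, map_sub, map_lie_of_weight e he hx ⁅y, _⁆, map_lie_of_weight e he hy ⁅x, _⁆]

/-- The `𝔰𝔩₂ ⊗ A`-subalgebra of a simple root acts on the generator through a character of the
grading group. -/
theorem exists_character_of_sl2 [FiniteDimensional ℂ 𝔥] {α : Module.Dual ℂ 𝔥} {h : 𝔥} {x y : 𝔤}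
    (t : IsSl2Triple (h : 𝔤) x y) (hx : ∀ k : 𝔥, ⁅(k : 𝔤), x⁆ = α k • x)
    (hy : ∀ k : 𝔥, ⁅(k : 𝔤), y⁆ = -α k • y) :
    ∃ lam : Fin n → ℂˣ,
      (∀ a, ⁅(elt x a : ToroidalAlgebra n 𝔤), e.symm 1⁆
          = (monoVal lam a : ℂ) • ⁅(elt x 0 : ToroidalAlgebra n 𝔤), e.symm 1⁆ ∧
        ⁅(elt y a : ToroidalAlgebra n 𝔤), e.symm 1⁆
          = (monoVal lam a : ℂ) • ⁅(elt y 0 : ToroidalAlgebra n 𝔤), e.symm 1⁆ ∧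
        ⁅(elt (h : 𝔤) a : ToroidalAlgebra n 𝔤), e.symm 1⁆
          = (monoVal lam a : ℂ) • ⁅(elt (h : 𝔤) 0 : ToroidalAlgebra n 𝔤), e.symm 1⁆) ∧
      (∃ v, e ⁅(elt x 0 : ToroidalAlgebra n 𝔤), e.symm 1⁆ = inclU n 𝔥 v) ∧
      (∃ v, e ⁅(elt y 0 : ToroidalAlgebra n 𝔤), e.symm 1⁆ = inclU n 𝔥 v) ∧
      ⁅(elt x 0 : ToroidalAlgebra n 𝔤), e.symm 1⁆ ≠ 0 := by
  have hhx : ⁅(h : 𝔤), x⁆ = (2 : ℂ) • x := by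
    rw [t.lie_h_e_nsmul, two_smul, two_smul]
  have hhy : ⁅(h : 𝔤), y⁆ = (-2 : ℂ) • y := by
    rw [t.lie_h_f_nsmul, neg_smul, two_smul, two_smul]
  have hα : α h = 2 := by
    have := hx h
    rw [hhx] at this
    exact (smul_left_injective ℂ t.e_ne_zero this).symm
  obtain ⟨m, Φ, τ, hτ, hΦh, hΦ⟩ := exists_adapted_polynomial (n := n) hα
  have wx : ∀ a (z : cartan n 𝔥), ⁅(z : ToroidalAlgebra n 𝔤), elt x a⁆
      = weight ((1 : ℤ) • α) a z • elt x a :=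
    fun a => cartan_lie_elt (by simpa using hx) a
  have wy : ∀ a (z : cartan n 𝔥), ⁅(z : ToroidalAlgebra n 𝔤), elt y a⁆
      = weight ((-1 : ℤ) • α) a z • elt y a :=
    fun a => cartan_lie_elt (by simpa using hy) a
  have wh : ∀ a (z : cartan n 𝔥), ⁅(z : ToroidalAlgebra n 𝔤), elt (h : 𝔤) a⁆
      = weight ((0 : ℤ) • α) a z • elt (h : 𝔤) a :=
    fun a => cartan_lie_elt (fun k => by
      rw [← LieSubalgebra.coe_bracket, trivial_lie_zero]; simp) a
  let E : (Fin n → ℤ) → Polynomial (MvPolynomial (Fin m) ℂ) :=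
    fun a => Φ (e ⁅(elt x a : ToroidalAlgebra n 𝔤), e.symm 1⁆)
  let F : (Fin n → ℤ) → Polynomial (MvPolynomial (Fin m) ℂ) :=
    fun a => Φ (e ⁅(elt y a : ToroidalAlgebra n 𝔤), e.symm 1⁆)
  let H : (Fin n → ℤ) → Polynomial (MvPolynomial (Fin m) ℂ) :=
    fun a => Φ (e ⁅(elt (h : 𝔤) a : ToroidalAlgebra n 𝔤), e.symm 1⁆)
  have key : ∀ {p q : 𝔤} {k k' : ℤ} {a b : Fin n → ℤ},
      (∀ z : cartan n 𝔥, ⁅(z : ToroidalAlgebra n 𝔤), elt p a⁆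
        = weight (k • α) a z • elt p a) →
      (∀ z : cartan n 𝔥, ⁅(z : ToroidalAlgebra n 𝔤), elt q b⁆
        = weight (k' • α) b z • elt q b) →
      Φ (e ⁅⁅(elt p a : ToroidalAlgebra n 𝔤), elt q b⁆, e.symm 1⁆)
        = Φ (e ⁅(elt p a : ToroidalAlgebra n 𝔤), e.symm 1⁆) *
          Polynomial.taylor ((-2 * k : ℤ) : MvPolynomial (Fin m) ℂ)
            ((Φ (e ⁅(elt q b : ToroidalAlgebra n 𝔤), e.symm 1⁆)).map (τ a))
        - Φ (e ⁅(elt q b : ToroidalAlgebra n 𝔤), e.symm 1⁆) *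
          Polynomial.taylor ((-2 * k' : ℤ) : MvPolynomial (Fin m) ℂ)
            ((Φ (e ⁅(elt p a : ToroidalAlgebra n 𝔤), e.symm 1⁆)).map (τ b)) := by
    intro p q k k' a b hp hq
    rw [map_lie_lie_of_weight e he hp hq, map_sub, map_mul, map_mul, hΦ, hΦ, mul_comm,
      mul_comm (Polynomial.taylor _ _) (Φ (e ⁅(elt q b : ToroidalAlgebra n 𝔤), e.symm 1⁆))]
  have hH0 : H 0 = Polynomial.X := by
    have : (cartanEquiv n 𝔥 (h, 0) : ToroidalAlgebra n 𝔤) = elt (h : 𝔤) 0 := by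
      rw [cartanEquiv_apply]
      ext1 <;> simp [degElt]
    change Φ (e ⁅_, _⁆) = _
    rw [← this, ← act_ι (cartan n 𝔥), he, e.apply_symm_apply, mul_one, hΦh]
  have S : LoopSl2System τ E F H := by
    refine ⟨hH0, fun a b => ?_, fun a b => ?_, fun a => ?_, fun a => ?_, fun a => ?_, fun a => ?_⟩
    · have := key (wh a) (wx b)
      rw [elt_lie_elt, killingForm_eq_zero_of_lie two_ne_zero hhx, zero_smul, add_zero, hhx,
        elt_smul, smul_lie, map_smul, map_smul, two_smul, ← two_mul] at this
      simpa using this.symm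
    · have := key (wh a) (wy b)
      rw [elt_lie_elt, killingForm_eq_zero_of_lie (by norm_num) hhy, zero_smul, add_zero, hhy,
        elt_smul, smul_lie, map_smul, map_smul, neg_smul, two_smul, ← two_mul] at this
      simpa using this.symm
    · have := key (wx a) (wy 0)
      rw [elt_lie_elt_of_zero_right, t.lie_e_f, hτ.zero, Polynomial.map_id] at this
      simpa using this.symm
    · have := key (wx 0) (wy a)
      rw [elt_lie_elt_of_zero_left, t.lie_e_f, hτ.zero, Polynomial.map_id] at this
      simpa using this.symm
    · have := key (wx a) (wx 0)
      rw [elt_lie_elt_of_zero_right, lie_self, elt_zero_vec, zero_lie, map_zero, map_zero,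
        hτ.zero, Polynomial.map_id, eq_comm, sub_eq_zero] at this
      simpa using this
    · have := key (wy a) (wy 0)
      rw [elt_lie_elt_of_zero_right, lie_self, elt_zero_vec, zero_lie, map_zero, map_zero,
        hτ.zero, Polynomial.map_id, eq_comm, sub_eq_zero] at this
      simpa using this
  obtain ⟨hE, hF, r, hru, hrmul, hr⟩ := S.exists_character hτ
  -- Units of a polynomial ring over `ℂ` are nonzero scalars, so the character takes complex values
  -- and is `a ↦ λ^a`.
  choose c hc hrc using fun a => MvPolynomial.isUnit_iff_eq_C_of_isReduced.1 (hru a)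
  obtain ⟨lam, hlam⟩ := exists_monoVal (fun a => (hc a).unit) fun a b => by
    ext
    apply MvPolynomial.C_injective (Fin m) ℂ
    simp [← hrc, hrmul]
  have hlam' : ∀ a, c a = monoVal lam a := fun a => by rw [← hlam]; rfl
  have hscal : ∀ (a : Fin n → ℤ) {v v' : N},
      Φ (e v) = Polynomial.C (r a) * Φ (e v') → v = (monoVal lam a : ℂ) • v' := by
    intro a v v' hv
    apply e.injective
    apply Φ.injective
    rw [hv, map_smul, map_smul, hrc, ← hlam', Algebra.smul_def]
    rfl
  have hinv : ∀ v : N, (∀ a, (Φ (e v)).map (τ a) = Φ (e v)) → ∃ v', e v = inclU n 𝔥 v' := by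
    intro v hv
    -- Translations of weight `(0, a)` leave the variable alone and act on coefficients by `τ a`.
    refine exists_inclU_eq fun a => Φ.injective ?_
    have := hΦ 0 a (e v)
    rw [zero_smul, hv] at this
    simpa using this
  refine ⟨lam, fun a => ⟨hscal a (hr a).1, hscal a (hr a).2.1, hscal a ?_⟩, hinv _ hE, hinv _ hF,
    fun h0 => S.E_ne_zero hτ 0 (by simp [E, h0])⟩
  rw [show Φ (e ⁅(elt (h : 𝔤) 0 : ToroidalAlgebra n 𝔤), e.symm 1⁆) = Polynomial.X from hH0]
  exact (hr a).2.2

end ToroidalAlgebra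

end

noncomputable section

lemma IsFreeRankOne.of_equiv {𝔞 : Type*} [LieRing 𝔞] [LieAlgebra ℂ 𝔞] {𝔟 : LieSubalgebra ℂ 𝔞}
    {N N' : Type*} [AddCommGroup N] [Module ℂ N] [LieRingModule 𝔞 N] [LieModule ℂ 𝔞 N]
    [AddCommGroup N'] [Module ℂ N'] [LieRingModule 𝔞 N'] [LieModule ℂ 𝔞 N']
    (φ : N ≃ₗ⁅ℂ, 𝔞⁆ N') (h : IsFreeRankOne 𝔟 N') : IsFreeRankOne 𝔟 N := by
  obtain ⟨e, he⟩ := h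
  refine isFreeRankOne_of_equiv (φ.toLinearEquiv.trans e) fun x v => ?_
  have := he (UniversalEnvelopingAlgebra.ι ℂ x) (φ v)
  rw [UniversalEnvelopingAlgebra.lift_ι_apply] at this
  change e (φ ⁅(x : 𝔞), v⁆) = _ * e (φ v)
  rw [show φ ⁅(x : 𝔞), v⁆ = ⁅(x : 𝔞), φ v⁆ from φ.map_lie x v, ← this]
  rfl

/-! ### Chevalley generators and the Killing form. -/

namespace LieAlgebra.Basis

variable {κ 𝔤 : Type*} [Fintype κ] [LieRing 𝔤] [LieAlgebra ℂ 𝔤] {𝔥 : LieSubalgebra ℂ 𝔤}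
  (b : LieAlgebra.Basis κ 𝔥)

lemma lie_e (i : κ) (k : 𝔥) : ⁅(k : 𝔤), b.e i⁆ = b.baseSupp i k • b.e i :=
  (b.baseSupp_apply_smul_e i k).symm

lemma lie_f (i : κ) (k : 𝔥) : ⁅(k : 𝔤), b.f i⁆ = -b.baseSupp i k • b.f i := by
  rw [neg_smul, b.baseSupp_apply_smul_f, neg_neg]
  rfl

/-- For `k` in `𝔥`, invariance gives `(hᵢ, k) = ([eᵢ, fᵢ], k) = αᵢ(k) (eᵢ, fᵢ)`. If `(eᵢ, fᵢ)` were
zero, `hᵢ` would lie in the radical of the Killing form restricted to `𝔥`, which is trivial. -/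
lemma killingForm_e_f_ne_zero [FiniteDimensional ℂ 𝔤] [LieAlgebra.IsKilling ℂ 𝔤] (i : κ) :
    killingForm ℂ 𝔤 (b.e i) (b.f i) ≠ 0 := by
  intro h0
  have := b.isCartanSubalgebra
  have h1 : b.h' i ∈ LinearMap.ker ((killingForm ℂ 𝔤).restrict 𝔥) := by
    refine LinearMap.ext fun k => ?_
    change killingForm ℂ 𝔤 (b.h i) (k : 𝔤) = 0
    rw [← (b.sl2 i).lie_e_f, killingForm, LieModule.traceForm_apply_lie_apply, ← lie_skew,
      b.lie_f, neg_smul, neg_neg, map_smul, ← killingForm, h0, smul_zero]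
  rw [LieAlgebra.IsKilling.ker_restrict_eq_bot_of_isCartanSubalgebra] at h1
  exact (b.sl2 i).h_ne_zero (congrArg Subtype.val ((Submodule.mem_bot ℂ).1 h1))

end LieAlgebra.Basis

/-! ### From Chevalley generators to the whole loop algebra and the centre. -/

namespace ToroidalAlgebra

open UniversalEnvelopingAlgebra

variable {n : ℕ} {𝔤 : Type*} [LieRing 𝔤] [LieAlgebra ℂ 𝔤] {𝔥 : LieSubalgebra ℂ 𝔤} [IsLieAbelian 𝔥]
  {N : Type*} [AddCommGroup N] [Module ℂ N] [LieRingModule (ToroidalAlgebra n 𝔤) N]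
  [LieModule ℂ (ToroidalAlgebra n 𝔤) N]

attribute [local instance] LieRing.ofAssociativeRing

variable (n 𝔥) in
/-- The projection `U(𝔥̃ₙ) → U(𝔥)` along `D`. -/
def projU : UniversalEnvelopingAlgebra ℂ (cartan n 𝔥) →ₐ[ℂ] UniversalEnvelopingAlgebra ℂ 𝔥 :=
  liftLinear ((ι ℂ : 𝔥 →ₗ⁅ℂ⁆ _).toLinearMap ∘ₗ LinearMap.fst ℂ 𝔥 (Fin n → ℂ) ∘ₗ
    (cartanEquiv n 𝔥).symm.toLinearMap) fun _ _ => mul_comm_of_isLieAbelian _ _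

lemma projU_inclU (v : UniversalEnvelopingAlgebra ℂ 𝔥) : projU n 𝔥 (inclU n 𝔥 v) = v := by
  have : (projU n 𝔥).comp (inclU n 𝔥) = AlgHom.id ℂ _ := algHom_ext_ι fun h => by
    rw [AlgHom.comp_apply, inclU_ι, projU, liftLinear_ι, LinearMap.comp_apply,
      LinearMap.comp_apply, LinearEquiv.coe_coe, LinearEquiv.symm_apply_apply]
    rfl
  exact AlgHom.congr_fun this v

/-- An element of degree `a` commutes with `ℂ[d₁, …, dₙ]` up to the shift by `a`. -/
lemma elt_lie_act_inclPD (x : 𝔤) (a : Fin n → ℤ) (p : PD n) (v : N) :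
    ⁅(elt x a : ToroidalAlgebra n 𝔤), act (cartan n 𝔥) N (inclPD n 𝔥 p) v⁆
      = act (cartan n 𝔥) N (inclPD n 𝔥 (shift a p)) ⁅(elt x a : ToroidalAlgebra n 𝔤), v⁆ := by
  induction p using MvPolynomial.induction_on generalizing v with
  | C r =>
    simp only [← MvPolynomial.algebraMap_eq, AlgHom.commutes, Module.algebraMap_end_apply, lie_smul]
  | add p q hp hq => simp only [map_add, LinearMap.add_apply, lie_add, hp, hq]
  | mul_X p i hp =>
    have hX : ∀ v : N, act (cartan n 𝔥) N (inclPD n 𝔥 (MvPolynomial.X i)) v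
        = ⁅(der i : ToroidalAlgebra n 𝔤), v⁆ := fun v => by
      rw [inclPD_X, act_ι, cartanEquiv_apply]
      congr 1
      ext1 <;> simp [elt, loopElt, degElt, der]
    rw [map_mul, map_mul, map_mul, map_mul, map_mul, Module.End.mul_apply, Module.End.mul_apply,
      hp, hX, shift_X, map_sub, map_sub, LinearMap.sub_apply, hX, leibniz_lie, ← lie_skew,
      der_lie_elt, neg_lie, smul_lie, ← MvPolynomial.algebraMap_eq, AlgHom.commutes,
      AlgHom.commutes, Module.algebraMap_end_apply, neg_add_eq_sub]

lemma elt_lie_act_inclU {α : Module.Dual ℂ 𝔥} {x : 𝔤} (hx : ∀ h : 𝔥, ⁅(h : 𝔤), x⁆ = α h • x)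
    (a : Fin n → ℤ) (v : UniversalEnvelopingAlgebra ℂ 𝔥) (w : N) :
    ⁅(elt x a : ToroidalAlgebra n 𝔤), act (cartan n 𝔥) N (inclU n 𝔥 v) w⁆
      = act (cartan n 𝔥) N (inclU n 𝔥 (weightShift α v))
          ⁅(elt x a : ToroidalAlgebra n 𝔤), w⁆ := by
  rw [lie_act (cartan_lie_elt hx a), weightShift_weight_inclU]

/-- If the Chevalley generators of degree `a` act on the generator of a free module through a
character of the grading group, then so does the whole loop algebra on `U(𝔥) · w`. -/
lemma exists_elt_lie_inclU {κ : Type*} [Fintype κ] (b : LieAlgebra.Basis κ 𝔥) {w : N}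
    {lam : Fin n → ℂˣ}
    (he : ∀ i a, ⁅(elt (b.e i) a : ToroidalAlgebra n 𝔤), w⁆
      = (monoVal lam a : ℂ) • ⁅(elt (b.e i) 0 : ToroidalAlgebra n 𝔤), w⁆)
    (hf : ∀ i a, ⁅(elt (b.f i) a : ToroidalAlgebra n 𝔤), w⁆
      = (monoVal lam a : ℂ) • ⁅(elt (b.f i) 0 : ToroidalAlgebra n 𝔤), w⁆)
    (he' : ∀ i, ∃ v, ⁅(elt (b.e i) 0 : ToroidalAlgebra n 𝔤), w⁆
      = act (cartan n 𝔥) N (inclU n 𝔥 v) w)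
    (hf' : ∀ i, ∃ v, ⁅(elt (b.f i) 0 : ToroidalAlgebra n 𝔤), w⁆
      = act (cartan n 𝔥) N (inclU n 𝔥 v) w)
    (x : 𝔤) (v : UniversalEnvelopingAlgebra ℂ 𝔥) :
    ∃ v', ∀ a, ⁅(elt x a : ToroidalAlgebra n 𝔤), act (cartan n 𝔥) N (inclU n 𝔥 v) w⁆
      = (monoVal lam a : ℂ) • act (cartan n 𝔥) N (inclU n 𝔥 v') w := by
  have gen : ∀ {α : Module.Dual ℂ 𝔥} {x : 𝔤}, (∀ h : 𝔥, ⁅(h : 𝔤), x⁆ = α h • x) →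
      (∀ a, ⁅(elt x a : ToroidalAlgebra n 𝔤), w⁆
        = (monoVal lam a : ℂ) • ⁅(elt x 0 : ToroidalAlgebra n 𝔤), w⁆) →
      (∃ v, ⁅(elt x 0 : ToroidalAlgebra n 𝔤), w⁆ = act (cartan n 𝔥) N (inclU n 𝔥 v) w) →
      ∀ v, ∃ v', ∀ a, ⁅(elt x a : ToroidalAlgebra n 𝔤), act (cartan n 𝔥) N (inclU n 𝔥 v) w⁆
        = (monoVal lam a : ℂ) • act (cartan n 𝔥) N (inclU n 𝔥 v') w := by
    rintro α x hx h1 ⟨v₀, h2⟩ v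
    refine ⟨weightShift α v * v₀, fun a => ?_⟩
    rw [elt_lie_act_inclU hx, h1, h2, map_smul, map_mul, map_mul, Module.End.mul_apply]
  let S : LieSubalgebra ℂ 𝔤 :=
    { carrier := {x | ∀ v, ∃ v', ∀ a,
        ⁅(elt x a : ToroidalAlgebra n 𝔤), act (cartan n 𝔥) N (inclU n 𝔥 v) w⁆
          = (monoVal lam a : ℂ) • act (cartan n 𝔥) N (inclU n 𝔥 v') w}
      zero_mem' := fun v => ⟨0, fun a => by simp [elt_zero_vec]⟩
      add_mem' := fun {x y} hx hy v => by
        obtain ⟨v₁, h₁⟩ := hx v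
        obtain ⟨v₂, h₂⟩ := hy v
        refine ⟨v₁ + v₂, fun a => ?_⟩
        rw [elt_add, add_lie, h₁, h₂, map_add, map_add, LinearMap.add_apply, smul_add]
      smul_mem' := fun r x hx v => by
        obtain ⟨v₁, h₁⟩ := hx v
        refine ⟨r • v₁, fun a => ?_⟩
        rw [elt_smul, smul_lie, h₁, map_smul, map_smul, LinearMap.smul_apply, smul_comm]
      -- The element `[x, y](a)` is written as `[x(a), y(0)]`, which has no central term.
      lie_mem' := fun {x y} hx hy v => by
        obtain ⟨v₁, h₁⟩ := hx v
        obtain ⟨v₂, h₂⟩ := hy v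
        obtain ⟨v₃, h₃⟩ := hx v₂
        obtain ⟨v₄, h₄⟩ := hy v₁
        refine ⟨v₃ - v₄, fun a => ?_⟩
        have m0 : (monoVal lam (0 : Fin n → ℤ) : ℂ) = 1 := by simp [monoVal]
        rw [← elt_lie_elt_of_zero_right, lie_lie, h₂ 0, m0, one_smul, h₃, h₁, lie_smul, h₄ 0, m0,
          one_smul, map_sub, map_sub, LinearMap.sub_apply, smul_sub] }
  have hS : S = ⊤ := by
    rw [eq_top_iff, ← b.span_ef, LieSubalgebra.lieSpan_le]
    rintro _ (⟨i, rfl⟩ | ⟨i, rfl⟩)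
    · exact gen (b.lie_e i) (he i) (he' i)
    · exact gen (α := -b.baseSupp i) (b.lie_f i) (hf i) (hf' i)
  exact (hS ▸ LieSubalgebra.mem_top x : x ∈ S) v

/-- If `e(a)`, `f(a)`, `h(a)` act on `w` through the same character, then the centre kills `w`. -/
lemma central_lie_eq_zero {α : Module.Dual ℂ 𝔥} {h x y : 𝔤} {w : N} {lam : Fin n → ℂˣ}
    (t : IsSl2Triple h x y) (hx : ∀ k : 𝔥, ⁅(k : 𝔤), x⁆ = α k • x)
    (hy : ∀ k : 𝔥, ⁅(k : 𝔤), y⁆ = -α k • y) (hxy : killingForm ℂ 𝔤 x y ≠ 0)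
    (hxw : ∀ a, ⁅(elt x a : ToroidalAlgebra n 𝔤), w⁆
      = (monoVal lam a : ℂ) • ⁅(elt x 0 : ToroidalAlgebra n 𝔤), w⁆)
    (hyw : ∀ a, ⁅(elt y a : ToroidalAlgebra n 𝔤), w⁆
      = (monoVal lam a : ℂ) • ⁅(elt y 0 : ToroidalAlgebra n 𝔤), w⁆)
    (hhw : ∀ a, ⁅(elt h a : ToroidalAlgebra n 𝔤), w⁆
      = (monoVal lam a : ℂ) • ⁅(elt h 0 : ToroidalAlgebra n 𝔤), w⁆)
    (hx' : ∃ v, ⁅(elt x 0 : ToroidalAlgebra n 𝔤), w⁆ = act (cartan n 𝔥) N (inclU n 𝔥 v) w)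
    (hy' : ∃ v, ⁅(elt y 0 : ToroidalAlgebra n 𝔤), w⁆ = act (cartan n 𝔥) N (inclU n 𝔥 v) w)
    (m : Fin n → ℤ) (j : Fin n) : ⁅(central m j : ToroidalAlgebra n 𝔤), w⁆ = 0 := by
  obtain ⟨v, hv⟩ := hx'
  obtain ⟨v', hv'⟩ := hy'
  have hx2 : ∀ a, ⁅(elt x a : ToroidalAlgebra n 𝔤), ⁅(elt y 0 : ToroidalAlgebra n 𝔤), w⁆⁆
      = (monoVal lam a : ℂ) •
        ⁅(elt x 0 : ToroidalAlgebra n 𝔤), ⁅(elt y 0 : ToroidalAlgebra n 𝔤), w⁆⁆ := fun a => by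
    rw [hv', elt_lie_act_inclU hx, elt_lie_act_inclU hx, hxw, map_smul]
  have hy2 : ∀ a, ⁅(elt y a : ToroidalAlgebra n 𝔤), ⁅(elt x 0 : ToroidalAlgebra n 𝔤), w⁆⁆
      = (monoVal lam a : ℂ) •
        ⁅(elt y 0 : ToroidalAlgebra n 𝔤), ⁅(elt x 0 : ToroidalAlgebra n 𝔤), w⁆⁆ := fun a => by
    rw [hv, elt_lie_act_inclU (α := -α) hy, elt_lie_act_inclU (α := -α) hy, hyw, map_smul]
  have key : ∀ a c : Fin n → ℤ, ⁅(∑ i, (a i : ℂ) • central (a + c) i : ToroidalAlgebra n 𝔤), w⁆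
      = 0 := by
    -- On `w`, both `[x(a), y(c)]` and `h(a + c)` act as `λ^(a + c) h(0)`, so the central term of
    -- the bracket kills `w`.
    intro a c
    have h1 := congrArg (fun z => ⁅z, w⁆) (elt_lie_elt x y a c)
    beta_reduce at h1
    rw [t.lie_e_f, add_lie, smul_lie, hhw, lie_lie, hyw, lie_smul, hx2, hxw, lie_smul, hy2,
      monoVal_add, Units.val_mul, smul_smul, smul_smul, mul_comm (monoVal lam c : ℂ), ← smul_sub,
      ← lie_lie, elt_lie_elt_of_zero_left, t.lie_e_f, left_eq_add, smul_eq_zero] at h1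
    exact h1.resolve_left hxy
  -- For the `j`-th unit vector the central sum reduces to the single term `t^m Kⱼ`.
  have := key (Pi.single j 1) (m - Pi.single j 1)
  rw [add_sub_cancel, Finset.sum_eq_single j (fun i _ hi => by simp [hi]) (by simp)] at this
  simpa using this

/-- The element `t^m Kⱼ` has weight `(0, m)`, so it commutes with `U(𝔥̃ₙ)` up to a translation. -/
lemma central_lie_act {w : N} {m : Fin n → ℤ} {j : Fin n}
    (h : ⁅(central m j : ToroidalAlgebra n 𝔤), w⁆ = 0)
    (u : UniversalEnvelopingAlgebra ℂ (cartan n 𝔥)) :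
    ⁅(central m j : ToroidalAlgebra n 𝔤), act (cartan n 𝔥) N u w⁆ = 0 := by
  rw [lie_act (χ := weight (0 : Module.Dual ℂ 𝔥) m) (fun y => ?_), h, map_zero]
  obtain ⟨p, rfl⟩ := (cartanEquiv n 𝔥).surjective y
  rw [weight_cartanEquiv, cartanEquiv_apply]
  ext1 <;> simp [elt, degElt, central, degLoop_zero, degK_zero, degK_tK]

end ToroidalAlgebra

end

noncomputable section

/-! ### Reconstruction of the `𝔤`-module and comparison of characters. -/

namespace ToroidalAlgebra

open UniversalEnvelopingAlgebra

variable {n : ℕ} {𝔤 : Type u} [LieRing 𝔤] [LieAlgebra ℂ 𝔤] {𝔥 : LieSubalgebra ℂ 𝔤} [IsLieAbelian 𝔥]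
  {N : Type v} [AddCommGroup N] [Module ℂ N] [LieRingModule (ToroidalAlgebra n 𝔤) N]
  [LieModule ℂ (ToroidalAlgebra n 𝔤) N]

attribute [local instance] LieRing.ofAssociativeRing

/-- The `𝔤`-module structure on `V` pulled back along an embedding into a `𝔤̃ₙ`-module. -/
abbrev lieRingModuleOfEmbedding {V : Type*} [AddCommGroup V] [Module ℂ V] (j : V →ₗ[ℂ] N)
    (hj : Function.Injective j) (ρ : 𝔤 → V → V)
    (hρ : ∀ x v, j (ρ x v) = ⁅(elt x 0 : ToroidalAlgebra n 𝔤), j v⁆) : LieRingModule 𝔤 V where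
  bracket := ρ
  add_lie x y v := hj (by
    rw [map_add, hρ, hρ, hρ, elt_add, add_lie])
  lie_add x v v' := hj (by
    rw [map_add, hρ, hρ, hρ, map_add, lie_add])
  leibniz_lie x y v := hj (by
    rw [map_add, hρ, hρ, hρ, hρ, hρ, leibniz_lie, elt_lie_elt_of_zero_left])

lemma lieModuleOfEmbedding {V : Type*} [AddCommGroup V] [Module ℂ V] (j : V →ₗ[ℂ] N)
    (hj : Function.Injective j) (ρ : 𝔤 → V → V)
    (hρ : ∀ x v, j (ρ x v) = ⁅(elt x 0 : ToroidalAlgebra n 𝔤), j v⁆) :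
    letI := lieRingModuleOfEmbedding j hj ρ hρ
    LieModule ℂ 𝔤 V :=
  letI := lieRingModuleOfEmbedding j hj ρ hρ
  { smul_lie := fun r x v => hj (by
      change j (ρ _ _) = j (r • ρ _ _)
      rw [map_smul, hρ, hρ, elt_smul, smul_lie])
    lie_smul := fun r x v => hj (by
      change j (ρ _ _) = j (r • ρ _ _)
      rw [map_smul, hρ, hρ, map_smul, lie_smul]) }

/-- A free module of rank one on which the loop algebra acts through a character of the grading
group and the centre acts by zero is a module `M̃(λ, M)`. -/
theorem exists_equiv_tildeModule (e : N ≃ₗ[ℂ] UniversalEnvelopingAlgebra ℂ (cartan n 𝔥))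
    (he : ∀ u v, e (act (cartan n 𝔥) N u v) = u * e v) (lam : Fin n → ℂˣ)
    (hloop : ∀ (x : 𝔤) (v : UniversalEnvelopingAlgebra ℂ 𝔥), ∃ v', ∀ a,
      ⁅(elt x a : ToroidalAlgebra n 𝔤), act (cartan n 𝔥) N (inclU n 𝔥 v) (e.symm 1)⁆
        = (monoVal lam a : ℂ) • act (cartan n 𝔥) N (inclU n 𝔥 v') (e.symm 1))
    (hcent : ∀ m j, ⁅(central m j : ToroidalAlgebra n 𝔤), e.symm 1⁆ = 0) :
    ∃ (M : Type u) (_ : AddCommGroup M) (_ : Module ℂ M)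
      (_ : LieRingModule 𝔤 M) (_ : LieModule ℂ 𝔤 M),
      IsFreeRankOne 𝔥 M ∧ Nonempty (N ≃ₗ⁅ℂ, ToroidalAlgebra n 𝔤⁆ TildeModule lam M) := by
  let V := UniversalEnvelopingAlgebra ℂ 𝔥
  let j : V →ₗ[ℂ] N := e.symm.toLinearMap ∘ₗ (inclU n 𝔥).toLinearMap
  have hj : ∀ v, j v = act (cartan n 𝔥) N (inclU n 𝔥 v) (e.symm 1) := fun v =>
    (act_symm_one e he _).symm
  have hinj : Function.Injective j := fun v v' h => by
    have h1 : inclU n 𝔥 v = inclU n 𝔥 v' := e.symm.injective h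
    rw [← projU_inclU (n := n) v, h1, projU_inclU]
  -- The operator `ρ x` on `U(𝔥)` does not depend on the degree; in degree `0` it is the action of
  -- `x` itself, hence the `𝔤`-module structure.
  choose ρ hρ using hloop
  have hρa : ∀ x a v, ⁅(elt x a : ToroidalAlgebra n 𝔤), j v⁆ = (monoVal lam a : ℂ) • j (ρ x v) :=
    fun x a v => by rw [hj, hρ, hj]
  have hρ0 : ∀ x v, j (ρ x v) = ⁅(elt x 0 : ToroidalAlgebra n 𝔤), j v⁆ := fun x v => by
    rw [hρa]; simp [monoVal]
  let i1 : LieRingModule 𝔤 V := lieRingModuleOfEmbedding j hinj ρ hρ0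
  let i2 : LieModule ℂ 𝔤 V := lieModuleOfEmbedding j hinj ρ hρ0
  have hbr : ∀ (x : 𝔤) (v : V), ⁅x, v⁆ = ρ x v := fun _ _ => rfl
  refine ⟨V, inferInstance, inferInstance, i1, i2, ?_, ⟨LieModuleEquiv.symm ?_⟩⟩
  · refine isFreeRankOne_of_equiv (LinearEquiv.refl ℂ V) fun x v => hinj ?_
    have hx : (cartanEquiv n 𝔥 (x, 0) : ToroidalAlgebra n 𝔤) = elt (x : 𝔤) 0 := by
      rw [cartanEquiv_apply]
      ext1 <;> simp [degElt]
    change j (ρ x v) = j (ι ℂ x * v)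
    rw [hρ0, hj, hj, map_mul, map_mul, Module.End.mul_apply, inclU_ι, act_ι, hx]
  · let L : TildeModule lam V ≃ₗ[ℂ] N := (tensorEquiv n 𝔥).toLinearEquiv.trans e.symm
    have hL : ∀ v p, L (TildeModule.mk lam V v p) = act (cartan n 𝔥) N (inclPD n 𝔥 p) (j v) := by
      intro v p
      change e.symm (inclU n 𝔥 v * inclPD n 𝔥 p) = _
      rw [mul_comm_of_isLieAbelian, ← act_symm_one e he, map_mul, Module.End.mul_apply, hj]
    let S : Submodule ℂ (ToroidalAlgebra n 𝔤) :=
      { carrier := {u | ∀ t, L ⁅u, t⁆ = ⁅u, L t⁆}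
        zero_mem' := fun t => by simp
        add_mem' := fun {u u'} hu hu' t => by rw [add_lie, map_add, hu, hu', add_lie]
        smul_mem' := fun r u hu t => by rw [smul_lie, map_smul, hu, smul_lie] }
    have hmem : ∀ u, (∀ v p, L ⁅u, TildeModule.mk lam V v p⁆ = ⁅u, L (TildeModule.mk lam V v p)⁆) →
        u ∈ S := by
      intro u hu t
      have : L.toLinearMap ∘ₗ LieModule.toEnd ℂ (ToroidalAlgebra n 𝔤) (TildeModule lam V) u
          = LieModule.toEnd ℂ (ToroidalAlgebra n 𝔤) N u ∘ₗ L.toLinearMap :=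
        TildeModule.hom_ext hu
      exact LinearMap.congr_fun this t
    have hS : S = ⊤ := by
      refine submodule_eq_top S (fun x a => hmem _ fun v p => ?_) (fun m k => hmem _ fun v p => ?_)
        fun k => hmem _ fun v p => ?_
      · rw [TildeModule.elt_lie_mk, map_smul, hL, hL, hbr, elt_lie_act_inclPD, hρa, map_smul]
      · rw [TildeModule.central_lie, map_zero, hL, hj, ← Module.End.mul_apply, ← map_mul,
          central_lie_act (hcent m k)]
      · rw [TildeModule.der_lie_mk, hL, hL, map_mul, map_mul, Module.End.mul_apply, inclPD_X, act_ι,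
          cartanEquiv_apply]
        congr 1
        ext1 <;> simp [elt, loopElt, degElt, der]
    exact { L with map_lie' := fun {u t} => (hS ▸ Submodule.mem_top : u ∈ S) t }

/-- The characters attached to two simple roots which are joined in the Dynkin diagram agree. -/
lemma monoVal_eq_of_lie {α : Module.Dual ℂ 𝔥} {h x : 𝔤} {w : N} {lam mu : Fin n → ℂˣ} {c : ℂ}
    (hc : c ≠ 0) (hhx : ⁅h, x⁆ = c • x) (hh : ∀ k : 𝔥, ⁅(k : 𝔤), h⁆ = α k • h)
    (hhw : ∀ a, ⁅(elt h a : ToroidalAlgebra n 𝔤), w⁆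
      = (monoVal lam a : ℂ) • ⁅(elt h 0 : ToroidalAlgebra n 𝔤), w⁆)
    (hxw : ∀ a, ⁅(elt x a : ToroidalAlgebra n 𝔤), w⁆
      = (monoVal mu a : ℂ) • ⁅(elt x 0 : ToroidalAlgebra n 𝔤), w⁆)
    (hx0 : ⁅(elt x 0 : ToroidalAlgebra n 𝔤), w⁆ ≠ 0)
    (hx' : ∃ v, ⁅(elt x 0 : ToroidalAlgebra n 𝔤), w⁆ = act (cartan n 𝔥) N (inclU n 𝔥 v) w)
    (a : Fin n → ℤ) : monoVal lam a = monoVal mu a := by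
  obtain ⟨v, hv⟩ := hx'
  have h1 : ⁅(elt h a : ToroidalAlgebra n 𝔤), ⁅(elt x 0 : ToroidalAlgebra n 𝔤), w⁆⁆
      = (monoVal lam a : ℂ) •
        ⁅(elt h 0 : ToroidalAlgebra n 𝔤), ⁅(elt x 0 : ToroidalAlgebra n 𝔤), w⁆⁆ := by
    rw [hv, elt_lie_act_inclU hh, elt_lie_act_inclU hh, hhw, map_smul]
  have h2 := congrArg (fun z => ⁅z, w⁆) (elt_lie_elt_of_zero_right h x a)
  beta_reduce at h2
  rw [lie_lie, h1, hhw, lie_smul, ← smul_sub, ← lie_lie, elt_lie_elt_of_zero_left, hhx, elt_smul,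
    elt_smul, smul_lie, smul_lie, hxw a, smul_comm] at h2
  have h3 := smul_left_injective ℂ hx0 (smul_right_injective N hc h2)
  exact Units.ext h3

end ToroidalAlgebra

end

/-! ### The classification. -/

theorem theorem4 {𝔤 : Type u} [LieRing 𝔤] [LieAlgebra ℂ 𝔤] [FiniteDimensional ℂ 𝔤]
    [LieAlgebra.IsSimple ℂ 𝔤] (𝔥 : LieSubalgebra ℂ 𝔤) (l : ℕ)
    (b : LieAlgebra.Basis (Fin l) 𝔥)
    (htype : (1 ≤ l ∧ b.A = CartanMatrix.A l) ∨ (2 ≤ l ∧ b.A = CartanMatrix.C l))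
    (n : ℕ)
    (N : Type v) [AddCommGroup N] [Module ℂ N] [LieRingModule (ToroidalAlgebra n 𝔤) N]
    [LieModule ℂ (ToroidalAlgebra n 𝔤) N] :
    IsFreeRankOne (ToroidalAlgebra.cartan n 𝔥) N ↔
      ∃ (lam : Fin n → ℂˣ) (M : Type u) (_ : AddCommGroup M) (_ : Module ℂ M)
        (_ : LieRingModule 𝔤 M) (_ : LieModule ℂ 𝔤 M),
        IsFreeRankOne 𝔥 M ∧
          Nonempty (N ≃ₗ⁅ℂ, ToroidalAlgebra n 𝔤⁆ TildeModule lam M) := by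
  have := b.isLieAbelian_cartan
  constructor
  · rintro ⟨e, he⟩
    choose lam hlam he' hf' hne using fun i =>
      ToroidalAlgebra.exists_character_of_sl2 e he (h := b.h' i) (b.sl2 i) (b.lie_e i) (b.lie_f i)
    have hact : ∀ {w : N}, (∃ v, e w = ToroidalAlgebra.inclU n 𝔥 v) →
        ∃ v, w = UniversalEnvelopingAlgebra.act (ToroidalAlgebra.cartan n 𝔥) N
          (ToroidalAlgebra.inclU n 𝔥 v) (e.symm 1) := by
      rintro w ⟨v, hv⟩
      refine ⟨v, ?_⟩
      rw [ToroidalAlgebra.act_symm_one e he, ← hv, e.symm_apply_apply]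
    have hl : 0 < l := by rcases htype with h | h <;> omega
    have hstep : ∀ (i j : Fin l), i.val + 1 = j.val →
        ∀ a, monoVal (lam j) a = monoVal (lam i) a := by
      intro i j hij a
      -- Consecutive nodes are joined in the diagrams of both types.
      have hA : b.A i j ≠ 0 := by
        have hne : i ≠ j := fun h => by simp [h] at hij
        rcases htype with ⟨-, h⟩ | ⟨-, h⟩ <;> rw [h] <;>
          simp [CartanMatrix.A, CartanMatrix.C, hne, hij]
      -- The bracket used is `[hⱼ, eᵢ] = A i j • eᵢ`; the element `hⱼ` has weight zero, whence `α :=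
      -- 0`.
      refine ToroidalAlgebra.monoVal_eq_of_lie (𝔥 := 𝔥) (α := 0) (c := (b.A i j : ℂ))
        (h := b.h j) (x := b.e i) (w := e.symm 1) (by exact_mod_cast hA) ?_ (fun k => ?_)
        (fun a => ((hlam j) a).2.2) (fun a => ((hlam i) a).1) (hne i) (hact (he' i)) a
      · rw [b.lie_h_e, Int.cast_smul_eq_zsmul]
      · change ⁅(k : 𝔤), ((b.h' j : 𝔥) : 𝔤)⁆ = _
        rw [← LieSubalgebra.coe_bracket, trivial_lie_zero]
        simp
    have hall : ∀ (k : ℕ) (hk : k < l) a, monoVal (lam ⟨k, hk⟩) a = monoVal (lam ⟨0, hl⟩) a := by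
      intro k
      induction k with
      | zero => exact fun _ _ => rfl
      | succ k ih =>
        intro hk a
        rw [hstep ⟨k, by omega⟩ ⟨k + 1, hk⟩ rfl, ih]
    have hall' : ∀ i a, monoVal (lam i) a = monoVal (lam ⟨0, hl⟩) a := fun i => hall i i.2
    -- The root vectors of a single node already show that the centre acts by zero.
    refine ⟨lam ⟨0, hl⟩, ToroidalAlgebra.exists_equiv_tildeModule e he _
      (ToroidalAlgebra.exists_elt_lie_inclU b ?_ ?_ (fun i => hact (he' i)) fun i => hact (hf' i))
      (ToroidalAlgebra.central_lie_eq_zero (b.sl2 ⟨0, hl⟩) (b.lie_e _) (b.lie_f _)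
        (b.killingForm_e_f_ne_zero _) (fun a => (hlam _ a).1) (fun a => (hlam _ a).2.1)
        (fun a => (hlam _ a).2.2) (hact (he' _)) (hact (hf' _)))⟩
    · intro i a
      rw [← hall' i]
      exact (hlam i a).1
    · intro i a
      rw [← hall' i]
      exact (hlam i a).2.1
  · rintro ⟨lam, M, _, _, _, _, hM, ⟨φ⟩⟩
    exact IsFreeRankOne.of_equiv φ (TildeModule.isFreeRankOne lam M hM)
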